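/- Let $\mathbb{R}^{4,2}$ be $\mathbb{R}^6$ with a metric $\langle\cdot,\cdot\rangle$ of signature $(4,2)$. An oriented $2$-sphere is a point $\mathrm{span}(s)$ of the projective light cone, that is, $s\neq0$ and $\langle s,s\rangle=0$. A contact element is a $2$-dimensional totally null subspace, and a Legendre map is a smooth family $f$ of contact elements, parametrized by a smooth surface $M$, with $\langle s,dt\rangle=0$ for all local sections $s,t$ of $f$. Two Legendre maps $f,\hat f$ on $M$ form a Ribaucour pair if $f(x)\cap\hat f(x)$ is one-dimensional for every $x\in M$ and their curvature directions coincide, where $0\neq v\in T_xM$ is a curvature direction of $f$ if some local section $s$ of $f$ with $s(x)\neq0$ satisfies $ds_x(v)\in f(x)$. For a non-null vector $b$, the Lie inversion is $\sigma_b(r)=r-\frac{2\langle r,b\rangle}{\langle b,b\rangle}b$. Fix a point sphere complex $p$, $\langle p,p\rangle=-1$. The point sphere of a contact element $F$ is $F\cap p^\perp$. Two spheres $s,t$ intersect orthogonally if $\langle s,t+\langle t,p\rangle p\rangle=0$. A circle is a $3$-dimensional subspace $\gamma\subset p^\perp$ of signature $(2,1)$, and a sphere $s$ intersects it orthogonally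 if $s$ intersects all spheres in $\gamma^\perp$ orthogonally. Let $a$ be non-null, let $f$ and $\hat f=\sigma_a(f)$ be a Ribaucour pair, and suppose that the point spheres of $f(x)$ and $\hat f(x)$ are distinct for every $x\in M$. With $r=f\cap\hat f$, let $$\gamma=\mathrm{span}\bigl(f\cap p^\perp,\ \hat f\cap p^\perp,\ r+\langle r,p\rangle p\bigr)$$ be the associated circle congruence. A Legendre map $g$ on $M$ is called orthogonal to $\gamma$ if, for every $x\in M$, all spheres of $g(x)$ intersect $\gamma(x)$ orthogonally. Then: 1. Each $\gamma(x)$ is a circle. 2. For every non-null $b\in\mathrm{span}(a,p)$, $\sigma_b(f)$ is a Legendre map orthogonal to $\gamma$. If $\sigma_b(f(x))=\sigma_{b'}(f(x))$ for non-null $b,b'\in\mathrm{span}(a,p)$ and some $x\in M$, then $\mathrm{span}(b)=\mathrm{span}(b')$. 3. For every null vector $b\neq0$ in $\mathrm{span}(a,p)$, the totally umbilic family $x\mapsto (f(x)\cap b^\perp)+\mathrm{span}(b)$ of contact elements of the sphere $b$ is a Legendre map orthogonal to $\gamma$. 4. If $M$ is connected, then the Legendre maps orthogonal to $\gamma$ are,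 up to a change of orientation (that is, up to applying $\sigma_p$), exactly the maps in 2 and 3. -/

import Mathlib

open scoped Manifold ContDiff

namespace LieSphere

/-- The six-dimensional vector space underlying `ℝ^{4,2}`. -/
abbrev R42 : Type := Fin 6 → ℝ

/-- The metric of signature `(4,2)` on `R42`. -/
noncomputable def lieForm : LinearMap.BilinForm ℝ R42 :=
  Matrix.toBilin' (Matrix.diagonal ![1, 1, 1, 1, -1, -1])

/-- The orthogonal complement `⟨b⟩^⊥` of a vector. -/
noncomputable def perp (b : R42) : Submodule ℝ R42 :=
  lieForm.orthogonal (Submodule.span ℝ {b})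

/-- `s` is a homogeneous coordinate vector of an oriented sphere: a nonzero lightlike vector. -/
def IsSphere (s : R42) : Prop := s ≠ 0 ∧ lieForm s s = 0

/-- A contact element: a two-dimensional totally lightlike subspace, that is, a line in the
Lie quadric. -/
def IsContactElement (F : Submodule ℝ R42) : Prop :=
  Module.finrank ℝ F = 2 ∧ ∀ s ∈ F, ∀ t ∈ F, lieForm s t = 0

/-- The Lie inversion `σ_b` with respect to the linear sphere complex of `b`
(used only for non-null `b`). -/
noncomputable def lieInversion (b : R42) : R42 →ₗ[ℝ] R42 :=
  LinearMap.id - (2 / lieForm b b) • (lieForm.flip b).smulRight b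

/-- The image `σ_b(F)` of a contact element. -/
noncomputable def invert (b : R42) (F : Submodule ℝ R42) : Submodule ℝ R42 :=
  F.map (lieInversion b)

/-- The contact element that contains the sphere `b` and the sphere of `F` in oriented contact
with `b` (used only for null `b` with `b ∉ F`). -/
noncomputable def umbilicElement (b : R42) (F : Submodule ℝ R42) : Submodule ℝ R42 :=
  (F ⊓ perp b) ⊔ Submodule.span ℝ {b}

section Moebius

/-- The point sphere of a contact element with respect to the point sphere complex `p`. -/
noncomputable def pointSphere (p : R42) (F : Submodule ℝ R42) : Submodule ℝ R42 :=
  F ⊓ perp p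

/-- Two spheres intersect orthogonally (with respect to the point sphere complex `p`). -/
def SpheresOrthogonal (p s t : R42) : Prop :=
  lieForm s (t + lieForm t p • p) = 0

/-- A `(2,1)`-plane: a three-dimensional subspace of signature `(2,1)`. -/
def IsPlane21 (W : Submodule ℝ R42) : Prop :=
  ∃ e : Fin 3 → R42, W = Submodule.span ℝ (Set.range e) ∧
    ∀ i j, lieForm (e i) (e j) = Matrix.diagonal ![(1 : ℝ), 1, -1] i j

/-- A circle `(γ, γ^⊥)`, represented by its `(2,1)`-plane `γ` orthogonal to `p`. -/
def IsCircle (p : R42) (γ : Submodule ℝ R42) : Prop :=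
  IsPlane21 γ ∧ γ ≤ perp p

/-- The circle `(γ, γ^⊥)` intersects the sphere `s` orthogonally: `s` intersects all spheres
in `γ^⊥` orthogonally. -/
def CircleOrthogonal (p : R42) (γ : Submodule ℝ R42) (s : R42) : Prop :=
  ∀ v ∈ lieForm.orthogonal γ, IsSphere v → SpheresOrthogonal p s v

/-- The linear map `s ↦ s + ⟨s,p⟩ p`. -/
noncomputable def pointProjection (p : R42) : R42 →ₗ[ℝ] R42 :=
  LinearMap.id + (lieForm.flip p).smulRight p

/-- For contact elements `F`, `G` with common sphere `r`: the span of the point spheres of `F`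
and `G` and of `r + ⟨r,p⟩ p`, that is, the circle through the two point spheres which
intersects `r` orthogonally. -/
noncomputable def associatedCircle (p : R42) (F G : Submodule ℝ R42) : Submodule ℝ R42 :=
  pointSphere p F ⊔ pointSphere p G ⊔ (F ⊓ G).map (pointProjection p)

end Moebius

section Legendre

variable {M : Type*} [TopologicalSpace M] [ChartedSpace (EuclideanSpace ℝ (Fin 2)) M]

/-- `s` is a smooth section of `f` over the open set `U`. -/
def IsSection (f : M → Submodule ℝ R42) (U : Set M) (s : M → R42) : Prop :=
  ContMDiffOn (𝓡 2) 𝓘(ℝ, R42) ∞ s U ∧ ∀ x ∈ U, s x ∈ f x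

/-- The derivative of an `R42`-valued map at `x` in the direction `v`. -/
noncomputable def sectionDeriv (s : M → R42) (x : M) (v : TangentSpace (𝓡 2) x) : R42 :=
  mfderiv (𝓡 2) 𝓘(ℝ, R42) s x v

/-- A Legendre map: a smooth family of contact elements (smooth: locally spanned by smooth
sections) such that `⟨s, dt⟩ = 0` for all local sections `s`, `t`. -/
def IsLegendreMap (f : M → Submodule ℝ R42) : Prop :=
  (∀ x, IsContactElement (f x)) ∧
  (∀ x, ∃ U : Set M, IsOpen U ∧ x ∈ U ∧ ∃ s t : M → R42, IsSection f U s ∧ IsSection f U t ∧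
    ∀ y ∈ U, f y = Submodule.span ℝ {s y, t y}) ∧
  (∀ U : Set M, IsOpen U → ∀ s t : M → R42, IsSection f U s → IsSection f U t →
    ∀ x ∈ U, ∀ v : TangentSpace (𝓡 2) x, lieForm (s x) (sectionDeriv t x v) = 0)

/-- `v` is a curvature direction of `f` at `x`: along `v`, some sphere of the contact element
`f x` (the curvature sphere) is stationary modulo `f x`. -/
def IsCurvatureDirection (f : M → Submodule ℝ R42) (x : M) (v : TangentSpace (𝓡 2) x) : Prop :=
  v ≠ 0 ∧ ∃ U : Set M, IsOpen U ∧ x ∈ U ∧ ∃ s : M → R42, IsSection f U s ∧ s x ≠ 0 ∧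
    sectionDeriv s x v ∈ f x

/-- A Ribaucour pair: two Legendre maps that envelop a common sphere congruence `x ↦ f x ⊓ g x`
such that curvature lines correspond. -/
def IsRibaucourPair (f g : M → Submodule ℝ R42) : Prop :=
  IsLegendreMap f ∧ IsLegendreMap g ∧ (∀ x, Module.finrank ℝ ↥(f x ⊓ g x) = 1) ∧
  ∀ x v, IsCurvatureDirection f x v ↔ IsCurvatureDirection g x v

/-- A family `g` of contact elements is orthogonal to a circle congruence `γ` on the same
parameter surface: each sphere of `g x` intersects the circle `γ x` orthogonally. -/
def OrthogonalTo (p : R42) (g γ : M → Submodule ℝ R42) : Prop :=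
  ∀ x, ∀ s ∈ g x, s ≠ 0 → CircleOrthogonal p (γ x) s

/-- The circle congruence associated to a Ribaucour pair. -/
noncomputable def circleCongruence (p : R42) (f g : M → Submodule ℝ R42) :
    M → Submodule ℝ R42 :=
  fun x => associatedCircle p (f x) (g x)

/-- The image `σ_b(f)` of a family of contact elements. -/
noncomputable def invertMap (b : R42) (f : M → Submodule ℝ R42) : M → Submodule ℝ R42 :=
  fun x => invert b (f x)

/-- The sphere `b`, regarded as a totally umbilic family of contact elements. -/
noncomputable def umbilicMap (b : R42) (f : M → Submodule ℝ R42) : M → Submodule ℝ R42 :=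
  fun x => umbilicElement b (f x)

end Legendre

/-- Representatives of the set `C_a`: the non-null vectors in `span(a, p)`. -/
def nonnullSpan (a p : R42) : Set R42 :=
  {b | b ∈ Submodule.span ℝ {a, p} ∧ lieForm b b ≠ 0}

/-- The spheres in `span(a, p)`: its nonzero null vectors. -/
def nullSpan (a p : R42) : Set R42 :=
  {b | b ∈ Submodule.span ℝ {a, p} ∧ IsSphere b}

end LieSphere

/-!
Write `W x = f x ⊔ span {a, p}`. As the point spheres are distinct, `⟨·, a⟩` and `⟨·, p⟩` are
independent functionals on `f x`; hence `W x` has signature `(2,2)` and equals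
`γ x ⊔ span {p}`, and a contact element is orthogonal to the circle `γ x` exactly when it lies in
`W x`. The null planes of `W x` fall into two families interchanged by `σ_p`, one of them consisting
of the planes `σ_b(f x)` and the umbilic contact elements of the null vectors of `span {a, p}`.

The basis of `f x` dual to the two functionals, together with the constants `a` and `p`, is a frame
of `W` whose derivatives are orthogonal to `W`. It is therefore parallel for a flat connection on
`W`, and a Legendre map inside `W` is parallel too, because the part of `ds` in `W` stays in the
contact element. On a connected surface such a map is determined by its value at one point.
-/

namespace LieSphere

open Module (finrank)

section BilinearForms

variable {R V : Type*} [CommRing R] [AddCommGroup V] [Module R V]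

theorem mem_orthogonal_span_iff {B : LinearMap.BilinForm R V} {S : Set V} {v : V} :
    v ∈ B.orthogonal (Submodule.span R S) ↔ ∀ u ∈ S, B u v = 0 := by
  refine ⟨fun hv u hu => hv u (Submodule.subset_span hu), fun hv u hu => ?_⟩
  have : Submodule.span R S ≤ LinearMap.ker (B.flip v) := Submodule.span_le.2 hv
  exact this hu

theorem finrank_span_pair [Nontrivial R] {u v : V} (huv : LinearIndependent R ![u, v]) :
    finrank R ↥(Submodule.span R {u, v}) = 2 := by
  have hrank := finrank_span_eq_card huv
  rwa [Matrix.range_cons_cons_empty, Fintype.card_fin] at hrank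

theorem det_ne_zero_of_linearIndependent [Nontrivial R] {φ ψ : V →ₗ[R] R} {s t : V}
    (hst : LinearIndependent R ![s, t])
    (hφψ : ∀ w ∈ Submodule.span R {s, t}, φ w = 0 → ψ w = 0 → w = 0) :
    φ s * ψ t - ψ s * φ t ≠ 0 := by
  intro hdet
  have hs : s ∈ Submodule.span R {s, t} := Submodule.subset_span (by simp)
  have ht : t ∈ Submodule.span R {s, t} := Submodule.subset_span (by simp)
  have hker (χ : V →ₗ[R] R) (hφ : φ s * χ t - χ s * φ t = 0) (hψ : ψ s * χ t - χ s * ψ t = 0) :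
      χ s = 0 := by
    have hw := hφψ (χ t • s + (-χ s) • t) (add_mem (Submodule.smul_mem _ _ hs)
      (Submodule.smul_mem _ _ ht)) (by simpa [mul_comm, sub_eq_add_neg] using hφ)
      (by simpa [mul_comm, sub_eq_add_neg] using hψ)
    simpa using (LinearIndependent.pair_iff.1 hst _ _ hw).2
  exact hst.ne_zero 0 (hφψ s hs (hker φ (by ring) (by linear_combination -hdet))
    (hker ψ hdet (by ring)))

theorem orthogonal_eq_sup_orthogonal {K V : Type*} [Field K] [AddCommGroup V] [Module K V]
    [FiniteDimensional K V] {B : LinearMap.BilinForm K V}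
    (hB : B.Nondegenerate) {G W : Submodule K V} (hGW : G ≤ W)
    (hG : G ≤ B.orthogonal G) (hW : Disjoint W (B.orthogonal W))
    (hdim : 2 * finrank K G = finrank K W) :
    B.orthogonal G = G ⊔ B.orthogonal W := by
  have hle : G ⊔ B.orthogonal W ≤ B.orthogonal G :=
    sup_le hG (LinearMap.BilinForm.orthogonal_le hGW)
  refine (Submodule.eq_of_le_of_finrank_eq hle ?_).symm
  have hsup := Submodule.finrank_sup_add_finrank_inf_eq G (B.orthogonal W)
  rw [(hW.mono_left hGW).eq_bot, finrank_bot] at hsup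
  have hG' := LinearMap.BilinForm.finrank_orthogonal hB G
  have hW' := LinearMap.BilinForm.finrank_orthogonal hB W
  have := Submodule.finrank_le W
  omega

end BilinearForms

section LieForm

variable {b v : R42}

theorem lieForm_apply (u v : R42) : lieForm u v =
    u 0 * v 0 + u 1 * v 1 + u 2 * v 2 + u 3 * v 3 - u 4 * v 4 - u 5 * v 5 := by
  simp only [lieForm, Matrix.toBilin'_apply', dotProduct, Matrix.mulVec_diagonal,
    Fin.sum_univ_six, Matrix.cons_val]
  ring

theorem lieForm_comm (u v : R42) : lieForm u v = lieForm v u := by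
  simp only [lieForm_apply]; ring

theorem nondegenerate_lieForm : lieForm.Nondegenerate :=
  LinearMap.BilinForm.nondegenerate_toBilin'_of_det_ne_zero' _ (by
    simp [Matrix.det_diagonal, Fin.prod_univ_six])

theorem mem_perp_iff : v ∈ perp b ↔ lieForm v b = 0 := by
  simp only [perp, mem_orthogonal_span_iff, Set.mem_singleton_iff, forall_eq, lieForm_comm v b]

theorem finrank_le_two_of_nonpos {N : Submodule ℝ R42} (hN : ∀ v ∈ N, lieForm v v ≤ 0) :
    finrank ℝ N ≤ 2 := by
  let timeCoords : R42 →ₗ[ℝ] Fin 2 → ℝ := LinearMap.funLeft ℝ ℝ ![4, 5]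
  have hinj : Function.Injective (timeCoords.domRestrict N) := by
    refine (injective_iff_map_eq_zero _).2 fun ⟨v, hv⟩ h => ?_
    have h4 : v 4 = 0 := congrFun h 0
    have h5 : v 5 = 0 := congrFun h 1
    have hneg := hN v hv
    rw [lieForm_apply, h4, h5] at hneg
    have hspace : ∀ i ∈ ({0, 1, 2, 3} : Set (Fin 6)), v i = 0 := by
      rintro i (rfl | rfl | rfl | rfl) <;> refine mul_self_eq_zero.1 ?_ <;>
        linarith [mul_self_nonneg (v 0), mul_self_nonneg (v 1), mul_self_nonneg (v 2),
          mul_self_nonneg (v 3)]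
    ext i
    fin_cases i <;> simp [h4, h5, hspace]
  simpa using LinearMap.finrank_le_finrank_of_injective hinj

end LieForm

section Inversion

variable {b v : R42} {F : Submodule ℝ R42}

theorem lieInversion_apply (b v : R42) :
    lieInversion b v = v - (2 / lieForm b b * lieForm v b) • b := by
  simp [lieInversion, smul_smul]

theorem lieInversion_of_mem_perp (hv : v ∈ perp b) : lieInversion b v = v := by
  simp [lieInversion_apply, mem_perp_iff.1 hv]

theorem lieForm_lieInversion (hb : lieForm b b ≠ 0) (u v : R42) :
    lieForm (lieInversion b u) (lieInversion b v) = lieForm u v := by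
  simp only [lieInversion_apply, map_sub, map_smul, LinearMap.sub_apply, LinearMap.smul_apply,
    smul_eq_mul, lieForm_comm b v]
  field_simp
  ring

theorem lieInversion_involutive (hb : lieForm b b ≠ 0) :
    Function.Involutive (lieInversion b) := fun v => by
  simp only [lieInversion_apply, map_sub, map_smul, div_mul_eq_mul_div, div_mul_cancel₀ _ hb]
  module

theorem mem_invert_iff (hb : lieForm b b ≠ 0) : v ∈ invert b F ↔ lieInversion b v ∈ F := by
  refine ⟨?_, fun hv => ⟨_, hv, lieInversion_involutive hb v⟩⟩
  rintro ⟨u, hu, rfl⟩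
  rwa [lieInversion_involutive hb u]

end Inversion

namespace IsContactElement

variable {b u w : R42} {F : Submodule ℝ R42}

theorem invert (hF : IsContactElement F) (hb : lieForm b b ≠ 0) :
    IsContactElement (invert b F) := by
  refine ⟨?_, ?_⟩
  · have hequiv := Submodule.equivMapOfInjective _ (lieInversion_involutive hb).injective F
    exact hequiv.finrank_eq.symm.trans hF.1
  · rintro _ ⟨u, hu, rfl⟩ _ ⟨v, hv, rfl⟩
    rw [lieForm_lieInversion hb, hF.2 u hu v hv]

/-- The signature `(4,2)` allows no negative semidefinite subspace of dimension three. -/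
theorem mem_of_mem_orthogonal (hF : IsContactElement F) (hw : w ∈ lieForm.orthogonal F)
    (hww : lieForm w w ≤ 0) : w ∈ F := by
  have hN : ∀ v ∈ F ⊔ Submodule.span ℝ {w}, lieForm v v ≤ 0 := by
    intro v hv
    obtain ⟨s, hs, t, ht, rfl⟩ := Submodule.mem_sup.1 hv
    obtain ⟨c, rfl⟩ := Submodule.mem_span_singleton.1 ht
    have hsw : lieForm s w = 0 := hw s hs
    simp only [map_add, map_smul, LinearMap.add_apply, LinearMap.smul_apply, smul_eq_mul,
      hF.2 s hs s hs, lieForm_comm w s, hsw]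
    nlinarith [mul_self_nonneg c]
  have hFN : F = F ⊔ Submodule.span ℝ {w} :=
    Submodule.eq_of_le_of_finrank_le le_sup_left (hF.1 ▸ finrank_le_two_of_nonpos hN)
  exact hFN ▸ Submodule.mem_sup_right (Submodule.mem_span_singleton_self w)

theorem not_le_perp (hF : IsContactElement F) (hbb : lieForm b b ≤ 0) (hb : b ∉ F) :
    ¬ F ≤ perp b :=
  fun hle => hb (hF.mem_of_mem_orthogonal (fun _ hv => mem_perp_iff.1 (hle hv)) hbb)

theorem notMem (hF : IsContactElement F) (hb : lieForm b b ≠ 0) : b ∉ F :=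
  fun hbF => hb (hF.2 b hbF b hbF)

theorem finrank_inf_perp (hF : IsContactElement F) (hb : ¬ F ≤ perp b) :
    finrank ℝ ↥(F ⊓ perp b) = 1 := by
  have hφ : (lieForm.flip b).domRestrict F ≠ 0 := fun h =>
    hb fun v hv => mem_perp_iff.2 (LinearMap.congr_fun h ⟨v, hv⟩)
  have hker : (LinearMap.ker ((lieForm.flip b).domRestrict F)).map F.subtype = F ⊓ perp b := by
    ext v
    simp [mem_perp_iff, and_comm]
  have := Module.Dual.finrank_ker_add_one_of_ne_zero hφ
  rw [← hker, Submodule.finrank_map_subtype_eq]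
  rw [hF.1] at this
  omega

theorem inf_perp_eq_span (hF : IsContactElement F) (hb : ¬ F ≤ perp b) (hu : u ∈ F)
    (hub : lieForm u b = 0) (hu0 : u ≠ 0) : F ⊓ perp b = Submodule.span ℝ {u} := by
  refine (Submodule.eq_of_le_of_finrank_eq ?_ ?_).symm
  · exact (Submodule.span_singleton_le_iff_mem _ _).2 ⟨hu, mem_perp_iff.2 hub⟩
  · rw [finrank_span_singleton hu0, hF.finrank_inf_perp hb]

theorem exists_inf_perp_eq_span (hF : IsContactElement F) (hb : ¬ F ≤ perp b) :
    ∃ u ∈ F, lieForm u b = 0 ∧ u ≠ 0 ∧ F ⊓ perp b = Submodule.span ℝ {u} := by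
  have : Nontrivial ↥(F ⊓ perp b) :=
    Module.nontrivial_of_finrank_pos (R := ℝ) (by rw [hF.finrank_inf_perp hb]; norm_num)
  obtain ⟨u, hu, hu0⟩ := Submodule.exists_mem_ne_zero_of_ne_bot
    ((Submodule.nontrivial_iff_ne_bot (p := F ⊓ perp b)).1 this)
  have hub := mem_perp_iff.1 hu.2
  exact ⟨u, hu.1, hub, hu0, hF.inf_perp_eq_span hb hu.1 hub hu0⟩

theorem inf_invert (hF : IsContactElement F) (hb : lieForm b b ≠ 0) :
    F ⊓ LieSphere.invert b F = F ⊓ perp b := by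
  ext v
  simp only [Submodule.mem_inf, mem_invert_iff hb, and_congr_right_iff]
  refine fun hv => ⟨fun hσ => ?_, fun hvb => (lieInversion_of_mem_perp hvb).symm ▸ hv⟩
  have hmem : (2 / lieForm b b * lieForm v b) • b ∈ F := by
    have := F.sub_mem hv hσ
    rwa [lieInversion_apply, sub_sub_cancel] at this
  rw [mem_perp_iff]
  by_contra hvb
  exact hF.notMem hb ((F.smul_mem_iff (by positivity)).1 hmem)

theorem umbilicElement (hF : IsContactElement F) (hbb : lieForm b b = 0) (hb : b ∉ F) :
    IsContactElement (umbilicElement b F) := by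
  have hb0 : b ≠ 0 := fun h => hb (h ▸ F.zero_mem)
  have hdisj : Disjoint (F ⊓ perp b) (Submodule.span ℝ {b}) :=
    (Submodule.disjoint_span_singleton' hb0).2 fun hmem => hb hmem.1
  constructor
  · have hsum := Submodule.finrank_sup_add_finrank_inf_eq (F ⊓ perp b) (Submodule.span ℝ {b})
    rwa [hdisj.eq_bot, finrank_bot, finrank_span_singleton hb0,
      hF.finrank_inf_perp (hF.not_le_perp hbb.le hb)] at hsum
  · intro s hs t ht
    obtain ⟨s, hsF, _, hsb, rfl⟩ := Submodule.mem_sup.1 hs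
    obtain ⟨t, htF, _, htb, rfl⟩ := Submodule.mem_sup.1 ht
    obtain ⟨k, rfl⟩ := Submodule.mem_span_singleton.1 hsb
    obtain ⟨l, rfl⟩ := Submodule.mem_span_singleton.1 htb
    simp [hF.2 s hsF.1 t htF.1, lieForm_comm b t, mem_perp_iff.1 hsF.2, mem_perp_iff.1 htF.2, hbb]

theorem eq_span_pair (hF : IsContactElement F) (huw : LinearIndependent ℝ ![u, w]) (hu : u ∈ F)
    (hw : w ∈ F) : F = Submodule.span ℝ {u, w} :=
  (Submodule.eq_of_le_of_finrank_eq (Submodule.span_le.2 (Set.pair_subset hu hw))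
    ((finrank_span_pair huw).trans hF.1.symm)).symm

theorem orthogonal_eq_sup (hF : IsContactElement F) {W : Submodule ℝ R42} (hFW : F ≤ W)
    (hW : Disjoint W (lieForm.orthogonal W)) (hdim : finrank ℝ W = 4) :
    lieForm.orthogonal F = F ⊔ lieForm.orthogonal W :=
  orthogonal_eq_sup_orthogonal nondegenerate_lieForm hFW (fun v hv s hs => hF.2 s hs v hv) hW
    (by rw [hF.1, hdim])

end IsContactElement

section Circle

variable {p u v w : R42} {γ : Submodule ℝ R42}

theorem isContactElement_span_pair (huv : LinearIndependent ℝ ![u, v]) (huu : lieForm u u = 0)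
    (huv' : lieForm u v = 0) (hvv : lieForm v v = 0) :
    IsContactElement (Submodule.span ℝ {u, v}) := by
  constructor
  · exact finrank_span_pair huv
  · intro s hs t ht
    obtain ⟨α, β, rfl⟩ := Submodule.mem_span_pair.1 hs
    obtain ⟨γ, δ, rfl⟩ := Submodule.mem_span_pair.1 ht
    simp [huu, huv', hvv, lieForm_comm v u]

theorem isPlane21_span (huu : lieForm u u = 0) (hvv : lieForm v v = 0) (huv : lieForm u v ≠ 0)
    (hww : lieForm w w = 1) (hwu : lieForm w u = 0) (hwv : lieForm w v = 0) :
    IsPlane21 (Submodule.span ℝ {u, v, w}) := by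
  set c := 1 / (2 * lieForm u v) with hc
  have hcuv : c * lieForm u v = 1 / 2 := by rw [hc]; field_simp
  refine ⟨![w, u + c • v, u - c • v], le_antisymm (Submodule.span_le.2 ?_)
    (Submodule.span_le.2 ?_), fun i j => ?_⟩
  · set S := Submodule.span ℝ (Set.range ![w, u + c • v, u - c • v])
    have hw : w ∈ S := Submodule.subset_span ⟨0, rfl⟩
    have hadd : u + c • v ∈ S := Submodule.subset_span ⟨1, rfl⟩
    have hsub : u - c • v ∈ S := Submodule.subset_span ⟨2, rfl⟩
    have hu : u = (1 / 2 : ℝ) • ((u + c • v) + (u - c • v)) := by module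
    have hv : v = lieForm u v • ((u + c • v) - (u - c • v)) := by
      linear_combination (norm := module) (-2 * hcuv) • v
    have hu_mem : u ∈ S := hu ▸ S.smul_mem _ (add_mem hadd hsub)
    have hv_mem : v ∈ S := hv ▸ S.smul_mem _ (sub_mem hadd hsub)
    rintro x (rfl | rfl | rfl)
    exacts [hu_mem, hv_mem, hw]
  · have hu := Submodule.subset_span (R := ℝ) (s := {u, v, w}) (Set.mem_insert u _)
    have hv := Submodule.subset_span (R := ℝ) (s := {u, v, w}) (show v ∈ _ by simp)
    have hw := Submodule.subset_span (R := ℝ) (s := {u, v, w}) (show w ∈ _ by simp)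
    rintro _ ⟨i, rfl⟩
    fin_cases i
    exacts [hw, add_mem hu (Submodule.smul_mem _ c hv), sub_mem hu (Submodule.smul_mem _ c hv)]
  · fin_cases i <;> fin_cases j <;>
      norm_num [huu, hvv, hww, hwu, hwv, hcuv, lieForm_comm u w, lieForm_comm v w,
        lieForm_comm v u]

/-- `IsCircle` supplies three of the four vectors of an orthonormal basis of `γ ⊕ span {p}`,
a subspace of signature `(2,2)`; its orthogonal complement is therefore positive definite. -/
theorem IsCircle.pos_of_mem_orthogonal (hp : lieForm p p = -1) (hγ : IsCircle p γ)
    (hu : u ∈ lieForm.orthogonal γ) (hup : lieForm u p = 0) (hu0 : u ≠ 0) : 0 < lieForm u u := by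
  obtain ⟨⟨e, rfl, he⟩, hγp⟩ := hγ
  have hep (i : Fin 3) : lieForm (e i) p = 0 :=
    mem_perp_iff.1 (hγp (Submodule.subset_span ⟨i, rfl⟩))
  have hpe (i : Fin 3) : lieForm p (e i) = 0 := (lieForm_comm _ _).trans (hep i)
  have heu (i : Fin 3) : lieForm u (e i) = 0 :=
    (lieForm_comm _ _).trans (hu _ (Submodule.subset_span ⟨i, rfl⟩))
  have he0 (α β : ℝ) : lieForm (α • (e 0 + e 2) + β • (e 1 + p)) (e 0) = α := by
    simp [he, hpe]
  have he1 (α β : ℝ) : lieForm (α • (e 0 + e 2) + β • (e 1 + p)) (e 1) = β := by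
    simp [he, hpe]
  have hF : IsContactElement (Submodule.span ℝ {e 0 + e 2, e 1 + p}) := by
    refine isContactElement_span_pair (LinearIndependent.pair_iff.2 fun α β h => ⟨?_, ?_⟩) ?_ ?_ ?_
    · rw [← he0 α β, h, map_zero, LinearMap.zero_apply]
    · rw [← he1 α β, h, map_zero, LinearMap.zero_apply]
    all_goals simp [he, hep, hpe, hp]
  have huF : u ∈ lieForm.orthogonal (Submodule.span ℝ {e 0 + e 2, e 1 + p}) := by
    refine mem_orthogonal_span_iff.2 ?_
    rintro _ (rfl | rfl) <;> rw [lieForm_comm] <;> simp [heu, hup]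
  by_contra! hneg
  obtain ⟨α, β, rfl⟩ := Submodule.mem_span_pair.1 (hF.mem_of_mem_orthogonal huF hneg)
  have hα : α = 0 := he0 α β ▸ heu 0
  have hβ : β = 0 := he1 α β ▸ heu 1
  exact hu0 (by simp [hα, hβ])

theorem IsCircle.exists_add_of_orthogonal (hp : lieForm p p = -1) (hγ : IsCircle p γ) (s : R42) :
    ∃ m ∈ γ ⊔ Submodule.span ℝ {p}, ∃ n ∈ lieForm.orthogonal γ, lieForm n p = 0 ∧ s = m + n := by
  obtain ⟨⟨e, rfl, he⟩, hγp⟩ := hγ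
  have hep (i : Fin 3) : lieForm (e i) p = 0 :=
    mem_perp_iff.1 (hγp (Submodule.subset_span ⟨i, rfl⟩))
  have hpe (i : Fin 3) : lieForm p (e i) = 0 := (lieForm_comm _ _).trans (hep i)
  set g := lieForm s (e 0) • e 0 + lieForm s (e 1) • e 1 - lieForm s (e 2) • e 2 with hg
  refine ⟨g - lieForm s p • p, sub_mem (Submodule.mem_sup_left ?_) ?_, s - (g - lieForm s p • p),
    mem_orthogonal_span_iff.2 ?_, ?_, (add_sub_cancel _ _).symm⟩
  · have hmem (i : Fin 3) : lieForm s (e i) • e i ∈ Submodule.span ℝ (Set.range e) :=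
      Submodule.smul_mem _ _ (Submodule.subset_span ⟨i, rfl⟩)
    exact sub_mem (add_mem (hmem 0) (hmem 1)) (hmem 2)
  · exact Submodule.mem_sup_right (Submodule.smul_mem _ _ (Submodule.mem_span_singleton_self p))
  · rintro _ ⟨i, rfl⟩
    rw [lieForm_comm]
    fin_cases i <;> simp [hg, he, hpe]
  · simp [hg, hep, hp]

theorem IsCircle.circleOrthogonal_iff (hp : lieForm p p = -1) (hγ : IsCircle p γ) {s : R42} :
    CircleOrthogonal p γ s ↔ s ∈ γ ⊔ Submodule.span ℝ {p} := by
  constructor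
  · intro hs
    obtain ⟨m, hm, n, hn, hnp, rfl⟩ := hγ.exists_add_of_orthogonal hp s
    suffices hn0 : n = 0 by simpa [hn0] using hm
    by_contra hn0
    have hpos := hγ.pos_of_mem_orthogonal hp hn hnp hn0
    have hmn : lieForm m n = 0 := by
      obtain ⟨g, hg, _, hc, rfl⟩ := Submodule.mem_sup.1 hm
      obtain ⟨c, rfl⟩ := Submodule.mem_span_singleton.1 hc
      simp [show lieForm g n = 0 from hn g hg, lieForm_comm p n, hnp]
    set c := √(lieForm n n)
    have hcc : c * c = lieForm n n := Real.mul_self_sqrt hpos.le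
    have hvp : lieForm (n + c • p) p = -c := by simp [hnp, hp]
    have hvγ : n + c • p ∈ lieForm.orthogonal γ :=
      add_mem hn (Submodule.smul_mem _ c fun g hg => mem_perp_iff.1 (hγ.2 hg))
    have hv : IsSphere (n + c • p) := by
      refine ⟨fun h => (Real.sqrt_pos.2 hpos).ne' ?_, ?_⟩
      · simpa [h] using hvp.symm
      · simp [hnp, lieForm_comm p n, hp, ← hcc]
    have hns : lieForm (m + n) (n + c • p + -c • p) = 0 := hvp ▸ hs _ hvγ hv
    have hnn : lieForm n n = 0 := by simpa [hmn] using hns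
    exact hpos.ne' hnn
  · intro hs v hv _
    obtain ⟨g, hg, _, hc, rfl⟩ := Submodule.mem_sup.1 hs
    obtain ⟨c, rfl⟩ := Submodule.mem_span_singleton.1 hc
    simp [SpheresOrthogonal, show lieForm g v = 0 from hv g hg, mem_perp_iff.1 (hγ.2 hg), hp,
      lieForm_comm p v]

end Circle

/-- `q, r` is the basis of the contact element `F` dual to the functionals `⟨·, a⟩` and `⟨·, p⟩`
on `F`. -/
structure IsDualFrame (a p : R42) (F : Submodule ℝ R42) (q r : R42) : Prop where
  contact : IsContactElement F
  left_mem : q ∈ F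
  right_mem : r ∈ F
  qa : lieForm q a = 1
  qp : lieForm q p = 0
  ra : lieForm r a = 0
  rp : lieForm r p = 1

namespace IsDualFrame

variable {a b p q r v w : R42} {F : Submodule ℝ R42}

theorem aq (h : IsDualFrame a p F q r) : lieForm a q = 1 := lieForm_comm q a ▸ h.qa

theorem pq (h : IsDualFrame a p F q r) : lieForm p q = 0 := lieForm_comm q p ▸ h.qp

theorem ar (h : IsDualFrame a p F q r) : lieForm a r = 0 := lieForm_comm r a ▸ h.ra

theorem pr (h : IsDualFrame a p F q r) : lieForm p r = 1 := lieForm_comm r p ▸ h.rp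

theorem qq (h : IsDualFrame a p F q r) : lieForm q q = 0 := h.contact.2 q h.left_mem q h.left_mem

theorem qr (h : IsDualFrame a p F q r) : lieForm q r = 0 := h.contact.2 q h.left_mem r h.right_mem

theorem rq (h : IsDualFrame a p F q r) : lieForm r q = 0 := h.contact.2 r h.right_mem q h.left_mem

theorem rr (h : IsDualFrame a p F q r) : lieForm r r = 0 := h.contact.2 r h.right_mem r h.right_mem

theorem left_ne_zero (h : IsDualFrame a p F q r) : q ≠ 0 := by
  rintro rfl
  simpa using h.qa

theorem right_ne_zero (h : IsDualFrame a p F q r) : r ≠ 0 := by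
  rintro rfl
  simpa using h.rp

theorem linearIndependent (h : IsDualFrame a p F q r) : LinearIndependent ℝ ![q, r] := by
  refine LinearIndependent.pair_iff.2 fun α β hαβ => ⟨?_, ?_⟩
  · simpa [h.qa, h.ra] using congrArg (lieForm.flip a) hαβ
  · simpa [h.qp, h.rp] using congrArg (lieForm.flip p) hαβ

theorem eq_span (h : IsDualFrame a p F q r) : F = Submodule.span ℝ {q, r} :=
  h.contact.eq_span_pair h.linearIndependent h.left_mem h.right_mem

theorem combination_eq_of_mem (h : IsDualFrame a p F q r) (hv : v ∈ F) :
    lieForm v a • q + lieForm v p • r = v := by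
  rw [h.eq_span] at hv
  obtain ⟨α, β, rfl⟩ := Submodule.mem_span_pair.1 hv
  simp [h.qa, h.qp, h.ra, h.rp]

theorem combination_eq_of_mem_span (h : IsDualFrame a p F q r) (hb : b ∈ Submodule.span ℝ {a, p}) :
    lieForm b q • a + lieForm b r • p = b := by
  obtain ⟨k, l, rfl⟩ := Submodule.mem_span_pair.1 hb
  simp [h.aq, h.pq, h.ar, h.pr]

theorem notMem_of_mem_span (h : IsDualFrame a p F q r) (hb : b ∈ Submodule.span ℝ {a, p})
    (hb0 : b ≠ 0) : b ∉ F := fun hbF => hb0 <| by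
  rw [← h.combination_eq_of_mem_span hb, h.contact.2 b hbF q h.left_mem,
    h.contact.2 b hbF r h.right_mem, zero_smul, zero_smul, add_zero]

theorem eq_zero_of_mem_sup (h : IsDualFrame a p F q r) (hw : w ∈ F ⊔ Submodule.span ℝ {a, p})
    (hq : lieForm w q = 0) (hr : lieForm w r = 0) (ha : lieForm w a = 0) (hp : lieForm w p = 0) :
    w = 0 := by
  obtain ⟨v, hv, b, hb, rfl⟩ := Submodule.mem_sup.1 hw
  have hb0 : b = 0 := by
    rw [map_add, LinearMap.add_apply, h.contact.2 v hv q h.left_mem, zero_add] at hq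
    rw [map_add, LinearMap.add_apply, h.contact.2 v hv r h.right_mem, zero_add] at hr
    rw [← h.combination_eq_of_mem_span hb, hq, hr, zero_smul, zero_smul, add_zero]
  rw [hb0, add_zero] at ha hp ⊢
  rw [← h.combination_eq_of_mem hv, ha, hp, zero_smul, zero_smul, add_zero]

theorem sup_eq_span (h : IsDualFrame a p F q r) :
    F ⊔ Submodule.span ℝ {a, p} = Submodule.span ℝ (Set.range ![q, r, a, p]) := by
  have : Set.range ![q, r, a, p] = {q, r} ∪ {a, p} := by
    simp only [Matrix.range_cons, Matrix.range_empty, Set.union_empty, Set.singleton_union,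
      Set.insert_union]
  rw [this, Submodule.span_union, ← h.eq_span]

theorem disjoint_orthogonal (h : IsDualFrame a p F q r) :
    Disjoint (F ⊔ Submodule.span ℝ {a, p})
      (lieForm.orthogonal (F ⊔ Submodule.span ℝ {a, p})) := by
  refine Submodule.disjoint_def.2 fun w hw hw' => ?_
  have hperp (i : Fin 4) : lieForm w (![q, r, a, p] i) = 0 := by
    rw [h.sup_eq_span, mem_orthogonal_span_iff] at hw'
    exact (lieForm_comm _ _).trans (hw' _ ⟨i, rfl⟩)
  exact h.eq_zero_of_mem_sup hw (hperp 0) (hperp 1) (hperp 2) (hperp 3)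

theorem finrank_sup (h : IsDualFrame a p F q r) :
    finrank ℝ ↥(F ⊔ Submodule.span ℝ {a, p}) = 4 := by
  have hap : LinearIndependent ℝ ![a, p] := by
    refine LinearIndependent.pair_iff.2 fun k l hkl => ⟨?_, ?_⟩
    · simpa [h.aq, h.pq] using congrArg (lieForm.flip q) hkl
    · simpa [h.ar, h.pr] using congrArg (lieForm.flip r) hkl
  have hdisj : F ⊓ Submodule.span ℝ {a, p} = ⊥ := by
    refine (Submodule.disjoint_def.2 fun b hbF hb => ?_).eq_bot
    by_contra hb0
    exact h.notMem_of_mem_span hb hb0 hbF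
  have hsum := Submodule.finrank_sup_add_finrank_inf_eq F (Submodule.span ℝ {a, p})
  rwa [hdisj, finrank_bot, h.contact.1, finrank_span_pair hap] at hsum

end IsDualFrame

theorem eq_zero_of_pointSphere_ne {a p v : R42} {F : Submodule ℝ R42} (hF : IsContactElement F)
    (ha : lieForm a a ≠ 0) (hp : lieForm p p < 0)
    (hpt : pointSphere p F ≠ pointSphere p (invert a F)) (hv : v ∈ F) (hva : lieForm v a = 0)
    (hvp : lieForm v p = 0) : v = 0 := by
  by_contra hv0
  have hσ := hF.invert ha
  have hvσ : v ∈ invert a F :=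
    (mem_invert_iff ha).2 ((lieInversion_of_mem_perp (mem_perp_iff.2 hva)).symm ▸ hv)
  refine hpt ?_
  rw [pointSphere, pointSphere,
    hF.inf_perp_eq_span (hF.not_le_perp hp.le (hF.notMem hp.ne)) hv hvp hv0,
    hσ.inf_perp_eq_span (hσ.not_le_perp hp.le (hσ.notMem hp.ne)) hvσ hvp hv0]

section AssociatedCircle

variable {a p q r : R42} {F : Submodule ℝ R42}

/-- The vector spanning the point sphere of `σ_a(F)` when `q, r` is the dual frame of `F`. -/
noncomputable def invertedPoint (a p q r : R42) : R42 :=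
  lieInversion a (q + (2 * lieForm a p / lieForm a a) • r)

namespace IsDualFrame

theorem invertedPoint_eq (h : IsDualFrame a p F q r) : invertedPoint a p q r =
    q + (2 * lieForm a p / lieForm a a) • r - (2 / lieForm a a) • a := by
  simp [invertedPoint, lieInversion_apply, h.qa, h.ra]

theorem lieForm_invertedPoint_left (h : IsDualFrame a p F q r) :
    lieForm q (invertedPoint a p q r) = -(2 / lieForm a a) := by
  simp [h.invertedPoint_eq, h.qq, h.qr, h.qa]

theorem lieForm_invertedPoint_right (h : IsDualFrame a p F q r) :
    lieForm r (invertedPoint a p q r) = 0 := by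
  simp [h.invertedPoint_eq, h.rq, h.rr, h.ra]

theorem lieForm_invertedPoint_p (h : IsDualFrame a p F q r) :
    lieForm (invertedPoint a p q r) p = 0 := by
  simp only [h.invertedPoint_eq, map_sub, map_add, map_smul, LinearMap.sub_apply,
    LinearMap.add_apply, LinearMap.smul_apply, smul_eq_mul, h.qp, h.rp]
  ring

theorem lieForm_invertedPoint_self (h : IsDualFrame a p F q r) (ha : lieForm a a ≠ 0) :
    lieForm (invertedPoint a p q r) (invertedPoint a p q r) = 0 := by
  simp [invertedPoint, lieForm_lieInversion ha, h.qq, h.qr, h.rq, h.rr]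

theorem associatedCircle_eq (h : IsDualFrame a p F q r) (ha : lieForm a a ≠ 0)
    (hp : lieForm p p < 0) : associatedCircle p F (invert a F) =
      Submodule.span ℝ {q, invertedPoint a p q r, r + p} := by
  have hσ := h.contact.invert ha
  have hpF := h.contact.not_le_perp hp.le (h.contact.notMem hp.ne)
  have hpσ := hσ.not_le_perp hp.le (hσ.notMem hp.ne)
  have haF : ¬ F ≤ perp a := fun hle => by simpa [h.qa] using mem_perp_iff.1 (hle h.left_mem)
  have hd0 : invertedPoint a p q r ≠ 0 := fun h0 => by
    simpa [h0, ha] using h.lieForm_invertedPoint_left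
  have hd : invertedPoint a p q r ∈ invert a F :=
    Submodule.mem_map_of_mem (F.add_mem h.left_mem (F.smul_mem _ h.right_mem))
  rw [associatedCircle, pointSphere, pointSphere,
    h.contact.inf_perp_eq_span hpF h.left_mem h.qp h.left_ne_zero,
    hσ.inf_perp_eq_span hpσ hd h.lieForm_invertedPoint_p hd0, h.contact.inf_invert ha,
    h.contact.inf_perp_eq_span haF h.right_mem h.ra h.right_ne_zero, Submodule.map_span,
    Set.image_singleton, Submodule.span_insert q, Submodule.span_insert _ {r + p}, sup_assoc]
  simp [pointProjection, h.rp]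

theorem isCircle_associatedCircle (h : IsDualFrame a p F q r) (ha : lieForm a a ≠ 0)
    (hp : lieForm p p = -1) : IsCircle p (associatedCircle p F (invert a F)) := by
  rw [h.associatedCircle_eq ha (by linarith)]
  refine ⟨isPlane21_span h.qq (h.lieForm_invertedPoint_self ha) ?_ ?_ ?_ ?_, Submodule.span_le.2 ?_⟩
  · rw [h.lieForm_invertedPoint_left]
    exact neg_ne_zero.2 (div_ne_zero two_ne_zero ha)
  · simp [h.rr, h.rp, h.pr, hp]
  · simp [h.rq, h.pq]
  · simp [h.lieForm_invertedPoint_right, lieForm_comm p, h.lieForm_invertedPoint_p]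
  · rintro _ (rfl | rfl | rfl)
    exacts [mem_perp_iff.2 h.qp, mem_perp_iff.2 h.lieForm_invertedPoint_p,
      mem_perp_iff.2 (by simp [h.rp, hp])]

theorem associatedCircle_sup_span (h : IsDualFrame a p F q r) (ha : lieForm a a ≠ 0)
    (hp : lieForm p p < 0) : associatedCircle p F (invert a F) ⊔ Submodule.span ℝ {p} =
      F ⊔ Submodule.span ℝ {a, p} := by
  have ha_eq : a = (lieForm a a / 2) • (q + (2 * lieForm a p / lieForm a a) • r -
      invertedPoint a p q r) := by
    rw [h.invertedPoint_eq, sub_sub_cancel, smul_smul, div_mul_div_cancel₀ two_ne_zero,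
      div_self ha, one_smul]
  rw [h.associatedCircle_eq ha hp]
  apply le_antisymm
  · set W := F ⊔ Submodule.span ℝ {a, p}
    have hq : q ∈ W := Submodule.mem_sup_left h.left_mem
    have hr : r ∈ W := Submodule.mem_sup_left h.right_mem
    have ha : a ∈ W := Submodule.mem_sup_right (Submodule.subset_span (by simp))
    have hp : p ∈ W := Submodule.mem_sup_right (Submodule.subset_span (by simp))
    have hd : invertedPoint a p q r ∈ W :=
      h.invertedPoint_eq ▸ sub_mem (add_mem hq (W.smul_mem _ hr)) (W.smul_mem _ ha)
    rw [← Submodule.span_union, Submodule.span_le]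
    rintro _ ((rfl | rfl | rfl) | rfl)
    exacts [hq, hd, add_mem hr hp, hp]
  · set W := Submodule.span ℝ {q, invertedPoint a p q r, r + p} ⊔ Submodule.span ℝ {p}
    have hq : q ∈ W := Submodule.mem_sup_left (Submodule.subset_span (by simp))
    have hd : invertedPoint a p q r ∈ W :=
      Submodule.mem_sup_left (Submodule.subset_span (by simp))
    have hp : p ∈ W := Submodule.mem_sup_right (Submodule.mem_span_singleton_self p)
    have hr : r ∈ W := by
      have hrp : r + p ∈ W := Submodule.mem_sup_left (Submodule.subset_span (by simp))
      exact (W.add_mem_iff_left hp).1 hrp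
    have ha : a ∈ W := ha_eq ▸ W.smul_mem _ (sub_mem (add_mem hq (W.smul_mem _ hr)) hd)
    rw [h.eq_span, ← Submodule.span_union, Submodule.span_le]
    rintro _ ((rfl | rfl) | (rfl | rfl))
    exacts [hq, hr, ha, hp]

end IsDualFrame

end AssociatedCircle

section Pencil

variable {a b b' p q r t u v : R42} {F G H S : Submodule ℝ R42}

theorem IsDualFrame.mem_span_singleton_of_inf_perp_le (h : IsDualFrame a p F q r)
    (hb : b ∈ Submodule.span ℝ {a, p}) (hb' : b' ∈ Submodule.span ℝ {a, p}) (hb0 : b ≠ 0)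
    (hle : F ⊓ perp b ≤ perp b') : b' ∈ Submodule.span ℝ {b} := by
  have hbq := h.combination_eq_of_mem_span hb
  have hbq' := h.combination_eq_of_mem_span hb'
  set k := lieForm b q
  set l := lieForm b r
  set k' := lieForm b' q
  set l' := lieForm b' r
  have hdet : l * k' = k * l' := by
    have hmem : l • q - k • r ∈ F ⊓ perp b :=
      ⟨F.sub_mem (F.smul_mem _ h.left_mem) (F.smul_mem _ h.right_mem), mem_perp_iff.2 <| by
        simp [lieForm_comm q b, lieForm_comm r b, k, l, mul_comm]⟩
    simpa [sub_eq_zero, lieForm_comm q b', lieForm_comm r b', k', l'] using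
      mem_perp_iff.1 (hle hmem)
  have hk : k • b' = k' • b := by
    rw [← hbq, ← hbq']
    linear_combination (norm := module) -hdet • p
  have hl : l • b' = l' • b := by
    rw [← hbq, ← hbq']
    linear_combination (norm := module) hdet • a
  have hkl : k ≠ 0 ∨ l ≠ 0 := by
    by_contra! hkl
    exact hb0 (by rw [← hbq, hkl.1, hkl.2, zero_smul, zero_smul, add_zero])
  rcases hkl with hk0 | hl0
  · exact ((Submodule.span ℝ {b}).smul_mem_iff hk0).1
      (hk ▸ Submodule.smul_mem _ _ (Submodule.mem_span_singleton_self b))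
  · exact ((Submodule.span ℝ {b}).smul_mem_iff hl0).1
      (hl ▸ Submodule.smul_mem _ _ (Submodule.mem_span_singleton_self b))

theorem IsDualFrame.span_singleton_eq_of_invert_eq (h : IsDualFrame a p F q r)
    (hb : b ∈ nonnullSpan a p) (hb' : b' ∈ nonnullSpan a p) (heq : invert b F = invert b' F) :
    Submodule.span ℝ {b} = Submodule.span ℝ {b'} := by
  have hinf : F ⊓ perp b = F ⊓ perp b' := by
    rw [← h.contact.inf_invert hb.2, heq, h.contact.inf_invert hb'.2]
  have hb0 : b ≠ 0 := fun h0 => hb.2 (by simp [h0])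
  have hb0' : b' ≠ 0 := fun h0 => hb'.2 (by simp [h0])
  apply le_antisymm <;> rw [Submodule.span_singleton_le_iff_mem]
  · exact h.mem_span_singleton_of_inf_perp_le hb'.1 hb.1 hb0' (hinf ▸ inf_le_right)
  · exact h.mem_span_singleton_of_inf_perp_le hb.1 hb'.1 hb0 (hinf ▸ inf_le_right)

theorem exists_lieForm_eq_one (hb : ¬ F ≤ perp b) : ∃ t ∈ F, lieForm t b = 1 := by
  obtain ⟨t, ht, htb⟩ := SetLike.not_le_iff_exists.1 hb
  rw [mem_perp_iff] at htb
  exact ⟨(lieForm t b)⁻¹ • t, F.smul_mem _ ht, by simp [htb]⟩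

theorem linearIndependent_pair_of_lieForm (hu0 : u ≠ 0) (hup : lieForm u p = 0)
    (htp : lieForm t p ≠ 0) : LinearIndependent ℝ ![u, t] :=
  (LinearIndependent.pair_iff' hu0).2 fun c hc => htp (by simp [← hc, hup])

theorem invert_le_sup (hb : b ∈ S) (hG : G ≤ F ⊔ S) : invert b G ≤ F ⊔ S := by
  rintro _ ⟨v, hv, rfl⟩
  rw [lieInversion_apply]
  exact sub_mem (hG hv) (Submodule.mem_sup_right (S.smul_mem _ hb))

theorem umbilicElement_le_sup (hb : b ∈ S) : umbilicElement b F ≤ F ⊔ S :=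
  sup_le_sup inf_le_left ((Submodule.span_singleton_le_iff_mem _ _).2 hb)

theorem mem_invert_add (hb : lieForm b b ≠ 0) (hv : v ∈ F)
    (hvb : lieForm (v + b) (v + b) = lieForm v v) : v + b ∈ invert b F := by
  have hcoef : 2 / lieForm b b * lieForm (v + b) b = 1 := by
    simp only [map_add, LinearMap.add_apply, lieForm_comm b v] at hvb ⊢
    field_simp
    linarith
  rwa [mem_invert_iff hb, lieInversion_apply, hcoef, one_smul, add_sub_cancel_right]

/-- The families in the pencil of (possibly degenerate) Lie inversions of `f` with respect to the
linear sphere complexes of `span {a, p}`; for a null vector `b` the umbilic family of `b` takes the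
place of `σ_b(f)`. -/
def inversionPencil {M : Type*} (a p : R42) (f : M → Submodule ℝ R42) :
    Set (M → Submodule ℝ R42) :=
  {h | (∃ b ∈ nonnullSpan a p, h = invertMap b f) ∨ ∃ b ∈ nullSpan a p, h = umbilicMap b f}

variable {M : Type*} {f h : M → Submodule ℝ R42} {x : M}

theorem le_sup_of_mem_inversionPencil (hh : h ∈ inversionPencil a p f) (x : M) :
    h x ≤ f x ⊔ Submodule.span ℝ {a, p} := by
  obtain ⟨b, hb, rfl⟩ | ⟨b, hb, rfl⟩ := hh
  exacts [invert_le_sup hb.1 le_sup_left, umbilicElement_le_sup hb.1]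

namespace IsDualFrame

theorem isContactElement_of_mem_inversionPencil (hF : IsDualFrame a p (f x) q r)
    (hh : h ∈ inversionPencil a p f) : IsContactElement (h x) := by
  obtain ⟨b, hb, rfl⟩ | ⟨b, hb, rfl⟩ := hh
  exacts [hF.contact.invert hb.2,
    hF.contact.umbilicElement hb.2.2 (hF.notMem_of_mem_span hb.1 hb.2.1)]

theorem exists_mem_inversionPencil_of_null (hF : IsDualFrame a p (f x) q r) (hp : lieForm p p ≠ 0)
    (hu : u ∈ f x ⊔ Submodule.span ℝ {a, p}) (huu : lieForm u u = 0) (hup : lieForm u p = 0) :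
    ∃ h ∈ inversionPencil a p f, u ∈ h x := by
  obtain ⟨v, hv, b, hb, rfl⟩ := Submodule.mem_sup.1 hu
  have hvv := hF.contact.2 v hv v hv
  rcases eq_or_ne b 0 with rfl | hb0
  · rw [add_zero] at hup ⊢
    refine ⟨_, Or.inl ⟨p, ⟨Submodule.subset_span (by simp), hp⟩, rfl⟩, (mem_invert_iff hp).2 ?_⟩
    rwa [lieInversion_of_mem_perp (mem_perp_iff.2 hup)]
  by_cases hbb : lieForm b b = 0
  · have hvb : lieForm v b = 0 := by
      simpa [hvv, hbb, lieForm_comm b v] using huu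
    exact ⟨_, Or.inr ⟨b, ⟨hb, hb0, hbb⟩, rfl⟩, Submodule.add_mem_sup ⟨hv, mem_perp_iff.2 hvb⟩
      (Submodule.mem_span_singleton_self b)⟩
  · exact ⟨_, Or.inl ⟨b, ⟨hb, hbb⟩, rfl⟩, mem_invert_add hbb hv (huu.trans hvv.symm)⟩

theorem orthogonal_inf_sup (hF : IsDualFrame a p F q r) (hG : IsContactElement G)
    (hGF : G ≤ F ⊔ Submodule.span ℝ {a, p}) :
    lieForm.orthogonal G ⊓ (F ⊔ Submodule.span ℝ {a, p}) = G := by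
  rw [hG.orthogonal_eq_sup hGF hF.disjoint_orthogonal hF.finrank_sup, sup_inf_assoc_of_le _ hGF,
    inf_comm, hF.disjoint_orthogonal.eq_bot, sup_bot_eq]

/-- `G` and `H` are spanned by `u` together with a vector having product `1` with `p`. The ones of
`G` and `H` differ by a multiple `c • p`, and nullity leaves only `c = 0` and `c = 2`. -/
theorem eq_or_eq_invert (hF : IsDualFrame a p F q r) (hp : lieForm p p = -1)
    (hG : IsContactElement G) (hH : IsContactElement H) (hGF : G ≤ F ⊔ Submodule.span ℝ {a, p})
    (hHF : H ≤ F ⊔ Submodule.span ℝ {a, p}) (hu0 : u ≠ 0) (hup : lieForm u p = 0) (huG : u ∈ G)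
    (huH : u ∈ H) : G = H ∨ G = invert p H := by
  have hp0 : lieForm p p ≠ 0 := by rw [hp]; norm_num
  obtain ⟨t, htG, htp⟩ :=
    exists_lieForm_eq_one (hG.not_le_perp (by linarith) (hG.notMem hp0))
  obtain ⟨t', htH, htp'⟩ :=
    exists_lieForm_eq_one (hH.not_le_perp (by linarith) (hH.notMem hp0))
  have hut := linearIndependent_pair_of_lieForm hu0 hup (by rw [htp]; exact one_ne_zero)
  have hut' := linearIndependent_pair_of_lieForm hu0 hup (by rw [htp']; exact one_ne_zero)
  have hG_eq {K : Submodule ℝ R42} (hK : IsContactElement K) (hu : u ∈ K) (ht : t ∈ K) : G = K :=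
    (hG.eq_span_pair hut huG htG).trans (hK.eq_span_pair hut hu ht).symm
  set c := -lieForm t t' with hc
  have htc : t + c • p ∈ H := by
    rw [← hF.orthogonal_inf_sup hH hHF]
    refine ⟨?_, add_mem (hGF htG) (Submodule.mem_sup_right
      (Submodule.smul_mem _ _ (Submodule.subset_span (by simp))))⟩
    rw [hH.eq_span_pair hut' huH htH]
    refine mem_orthogonal_span_iff.2 ?_
    rintro _ (rfl | rfl)
    · simp [hG.2 _ huG t htG, hup]
    · simp [htp', hc, lieForm_comm t]
  have hc02 : c * (c - 2) = 0 := by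
    have hnull := hH.2 _ htc _ htc
    simp only [map_add, map_smul, LinearMap.add_apply, LinearMap.smul_apply, smul_eq_mul,
      hG.2 t htG t htG, htp, lieForm_comm p t, hp] at hnull
    linarith
  rcases mul_eq_zero.1 hc02 with hc0 | hc2
  · exact Or.inl (hG_eq hH huH (by simpa [hc0] using htc))
  · refine Or.inr (hG_eq (hH.invert hp0) ((mem_invert_iff hp0).2 ?_) ((mem_invert_iff hp0).2 ?_))
    · rwa [lieInversion_of_mem_perp (mem_perp_iff.2 hup)]
    · rw [sub_eq_zero.1 hc2] at htc
      rwa [lieInversion_apply, htp, hp, mul_one, div_neg, div_one, neg_smul, sub_neg_eq_add]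

theorem exists_mem_inversionPencil_eq (hF : IsDualFrame a p (f x) q r) (hp : lieForm p p = -1)
    (hG : IsContactElement G) (hGF : G ≤ f x ⊔ Submodule.span ℝ {a, p}) :
    ∃ h ∈ inversionPencil a p f, G = h x ∨ G = invert p (h x) := by
  have hp0 : lieForm p p ≠ 0 := by rw [hp]; norm_num
  obtain ⟨u, huG, hup, hu0, -⟩ :=
    hG.exists_inf_perp_eq_span (hG.not_le_perp (by linarith) (hG.notMem hp0))
  obtain ⟨h, hh, huh⟩ :=
    hF.exists_mem_inversionPencil_of_null hp0 (hGF huG) (hG.2 u huG u huG) hup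
  exact ⟨h, hh, hF.eq_or_eq_invert hp hG (hF.isContactElement_of_mem_inversionPencil hh) hGF
    (le_sup_of_mem_inversionPencil hh x) hu0 hup huG huh⟩

end IsDualFrame

theorem orthogonalTo_circleCongruence_iff (hf : ∀ x, ∃ q r, IsDualFrame a p (f x) q r)
    (ha : lieForm a a ≠ 0) (hp : lieForm p p = -1) {g : M → Submodule ℝ R42} :
    OrthogonalTo p g (circleCongruence p f (invertMap a f)) ↔
      ∀ x, g x ≤ f x ⊔ Submodule.span ℝ {a, p} := by
  refine forall_congr' fun x => ?_
  obtain ⟨q, r, hqr⟩ := hf x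
  have hiff (s : R42) : CircleOrthogonal p (associatedCircle p (f x) (invert a (f x))) s ↔
      s ∈ f x ⊔ Submodule.span ℝ {a, p} := by
    rw [(hqr.isCircle_associatedCircle ha hp).circleOrthogonal_iff hp,
      hqr.associatedCircle_sup_span ha (by linarith)]
  refine ⟨fun H s hs => ?_, fun H s hs _ => (hiff s).2 (H hs)⟩
  rcases eq_or_ne s 0 with rfl | hs0
  exacts [zero_mem _, (hiff s).1 (H s hs hs0)]

end Pencil

section Calculus

variable {E H F : Type*} [NormedAddCommGroup E] [NormedSpace ℝ E] [TopologicalSpace H]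
  {I : ModelWithCorners ℝ E H} {M : Type*} [TopologicalSpace M] [ChartedSpace H M]
  [NormedAddCommGroup F] [NormedSpace ℝ F] {x : M}

theorem eventually_eq_of_hasMFDerivAt_zero [I.Boundaryless] [IsManifold I 1 M] {φ : M → F}
    (hφ : ∀ᶠ y in nhds x, HasMFDerivAt I 𝓘(ℝ, F) φ y 0) : ∀ᶠ y in nhds x, φ y = φ x := by
  set e := extChartAt I x
  have he : ContinuousAt e.symm (e x) := continuousAt_extChartAt_symm x
  have htarget : e.target ∈ nhds (e x) := extChartAt_target_mem_nhds x
  have hex : e.symm (e x) = x := extChartAt_to_inv x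
  have hφ' : ∀ᶠ z in nhds (e x), HasMFDerivAt I 𝓘(ℝ, F) φ (e.symm z) 0 :=
    he.eventually (by rwa [hex])
  obtain ⟨ε, hε, hball⟩ := Metric.eventually_nhds_iff_ball.1 (hφ'.and htarget)
  have hderiv : ∀ z ∈ Metric.ball (e x) ε, HasFDerivAt (φ ∘ e.symm) (0 : E →L[ℝ] F) z := by
    intro z hz
    have hsymm : MDifferentiableAt 𝓘(ℝ, E) I e.symm z :=
      (mdifferentiableOn_extChartAt_symm z (hball z hz).2).mdifferentiableAt
        ((isOpen_extChartAt_target x).mem_nhds (hball z hz).2)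
    have hcomp := (hball z hz).1.comp z hsymm.hasMFDerivAt
    rw [ContinuousLinearMap.zero_comp] at hcomp
    exact hcomp.hasFDerivAt
  filter_upwards [(continuousAt_extChartAt x).preimage_mem_nhds (Metric.ball_mem_nhds (e x) hε),
    extChartAt_source_mem_nhds (I := I) x] with y hy hys
  have hconst := Metric.isOpen_ball.is_const_of_fderiv_eq_zero
    (convex_ball (e x) ε).isPreconnected
    (fun z hz => (hderiv z hz).differentiableAt.differentiableWithinAt)
    (fun z hz => (hderiv z hz).fderiv) hy (Metric.mem_ball_self hε)
  rwa [Function.comp_apply, Function.comp_apply, hex, e.left_inv hys] at hconst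

variable {F₁ F₂ : Type*} [NormedAddCommGroup F₁] [NormedSpace ℝ F₁] [NormedAddCommGroup F₂]
  [NormedSpace ℝ F₂]

theorem hasMFDerivAt_of_bilinear (B : F₁ →L[ℝ] F₂ →L[ℝ] F) {s : M → F₁} {t : M → F₂}
    {s' : TangentSpace I x →L[ℝ] F₁} {t' : TangentSpace I x →L[ℝ] F₂}
    (hs : HasMFDerivAt I 𝓘(ℝ, F₁) s x s') (ht : HasMFDerivAt I 𝓘(ℝ, F₂) t x t') :
    HasMFDerivAt I 𝓘(ℝ, F) (fun y => B (s y) (t y)) x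
      ((B (s x)).comp t' + (B.flip (t x)).comp s') := by
  refine ⟨(B.isBoundedBilinearMap.continuous.tendsto _).comp (hs.1.prodMk_nhds ht.1), ?_⟩
  have hB := B.hasFDerivWithinAt_of_bilinear hs.2 ht.2
  simp only [writtenInExtChartAt, Function.comp_apply, extChartAt_to_inv] at hB
  exact hB

end Calculus

theorem IsContactElement.linearIndependent {u w : R42}
    (h : IsContactElement (Submodule.span ℝ {u, w})) : LinearIndependent ℝ ![u, w] := by
  rw [linearIndependent_iff_card_eq_finrank_span, Matrix.range_cons_cons_empty, Set.finrank, h.1,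
    Fintype.card_fin]

theorem IsContactElement.inf_perp_span_pair {b u w : R42}
    (hF : IsContactElement (Submodule.span ℝ {u, w})) (hb : ¬ Submodule.span ℝ {u, w} ≤ perp b) :
    Submodule.span ℝ {u, w} ⊓ perp b =
      Submodule.span ℝ {lieForm w b • u - lieForm u b • w} := by
  refine hF.inf_perp_eq_span hb (sub_mem (Submodule.smul_mem _ _ (Submodule.subset_span (by simp)))
    (Submodule.smul_mem _ _ (Submodule.subset_span (by simp)))) (by simp [mul_comm]) fun h0 => ?_
  have hcoef := LinearIndependent.pair_iff.1 hF.linearIndependent (lieForm w b) (-lieForm u b)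
    (by rw [neg_smul, ← sub_eq_add_neg, h0])
  refine hb (Submodule.span_le.2 ?_)
  rintro _ (rfl | rfl)
  exacts [mem_perp_iff.2 (neg_eq_zero.1 hcoef.2), mem_perp_iff.2 hcoef.1]

section Sections

variable {M : Type*} [TopologicalSpace M] [ChartedSpace (EuclideanSpace ℝ (Fin 2)) M]
  {b : R42} {f g : M → Submodule ℝ R42} {s t : M → R42} {U : Set M} {x : M}

theorem IsSection.mdifferentiableAt (hs : IsSection f U s) (hU : U ∈ nhds x) :
    MDifferentiableAt (𝓡 2) 𝓘(ℝ, R42) s x :=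
  (hs.1.contMDiffAt hU).mdifferentiableAt (by simp)

theorem contMDiffOn_lieForm (hs : ContMDiffOn (𝓡 2) 𝓘(ℝ, R42) ∞ s U)
    (ht : ContMDiffOn (𝓡 2) 𝓘(ℝ, R42) ∞ t U) :
    ContMDiffOn (𝓡 2) 𝓘(ℝ, ℝ) ∞ (fun y => lieForm (s y) (t y)) U :=
  have hsmooth := (LinearMap.toContinuousBilinearMap lieForm).isBoundedBilinearMap.contDiff (n := ∞)
  hsmooth.contMDiff.comp_contMDiffOn (hs.prodMk_space ht)

theorem hasMFDerivAt_lieForm_zero_iff (hs : MDifferentiableAt (𝓡 2) 𝓘(ℝ, R42) s x)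
    (ht : MDifferentiableAt (𝓡 2) 𝓘(ℝ, R42) t x) :
    HasMFDerivAt (𝓡 2) 𝓘(ℝ, ℝ) (fun y => lieForm (s y) (t y)) x 0 ↔
      ∀ v, lieForm (s x) (sectionDeriv t x v) + lieForm (sectionDeriv s x v) (t x) = 0 := by
  have h := hasMFDerivAt_of_bilinear (LinearMap.toContinuousBilinearMap lieForm)
    hs.hasMFDerivAt ht.hasMFDerivAt
  refine ⟨fun h0 v => DFunLike.congr_fun (hasMFDerivAt_unique h h0) v, fun h0 => ?_⟩
  exact h.congr_mfderiv (ContinuousLinearMap.ext h0)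

theorem lieForm_sectionDeriv_add_of_eventually_eq (hs : MDifferentiableAt (𝓡 2) 𝓘(ℝ, R42) s x)
    (ht : MDifferentiableAt (𝓡 2) 𝓘(ℝ, R42) t x) {c : ℝ}
    (hc : ∀ᶠ y in nhds x, lieForm (s y) (t y) = c) (v : TangentSpace (𝓡 2) x) :
    lieForm (s x) (sectionDeriv t x v) + lieForm (sectionDeriv s x v) (t x) = 0 :=
  (hasMFDerivAt_lieForm_zero_iff hs ht).1
    ((hasMFDerivAt_const c x).congr_of_eventuallyEq hc) v

theorem sectionDeriv_const (b : R42) (v : TangentSpace (𝓡 2) x) :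
    sectionDeriv (fun _ => b) x v = 0 := by
  rw [sectionDeriv, mfderiv_const]
  rfl

theorem sectionDeriv_map (L : R42 →ₗ[ℝ] R42) (hs : MDifferentiableAt (𝓡 2) 𝓘(ℝ, R42) s x)
    (v : TangentSpace (𝓡 2) x) : sectionDeriv (fun y => L (s y)) x v = L (sectionDeriv s x v) := by
  have hL := L.toContinuousLinearMap.hasFDerivAt (x := s x) |>.hasMFDerivAt
  have hcomp := hL.comp x hs.hasMFDerivAt
  exact DFunLike.congr_fun hcomp.mfderiv v

theorem IsLegendreMap.sectionDeriv_mem_orthogonal (hf : IsLegendreMap f) (hU : IsOpen U)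
    (hs : IsSection f U s) (hx : x ∈ U) (v : TangentSpace (𝓡 2) x) :
    sectionDeriv s x v ∈ lieForm.orthogonal (f x) := by
  obtain ⟨V, hV, hxV, t₁, t₂, ht₁, ht₂, hspan⟩ := hf.2.1 x
  have hmono {t : M → R42} (ht : IsSection f V t) : IsSection f (U ∩ V) t :=
    ⟨ht.1.mono Set.inter_subset_right, fun y hy => ht.2 y hy.2⟩
  have hs' : IsSection f (U ∩ V) s := ⟨hs.1.mono Set.inter_subset_left, fun y hy => hs.2 y hy.1⟩
  have hperp {t : M → R42} (ht : IsSection f V t) : lieForm (t x) (sectionDeriv s x v) = 0 :=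
    hf.2.2 _ (hU.inter hV) t s (hmono ht) hs' x ⟨hx, hxV⟩ v
  rw [hspan x hxV]
  refine mem_orthogonal_span_iff.2 ?_
  rintro _ (rfl | rfl)
  exacts [hperp ht₁, hperp ht₂]

theorem isLegendreMap_of_frame (hg : ∀ x, IsContactElement (g x))
    (hframe : ∀ x, ∃ U : Set M, IsOpen U ∧ x ∈ U ∧ ∃ s t : M → R42, IsSection g U s ∧
      IsSection g U t ∧ (∀ y ∈ U, g y = Submodule.span ℝ {s y, t y}) ∧
      ∀ v, sectionDeriv s x v ∈ lieForm.orthogonal (g x) ∧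
        sectionDeriv t x v ∈ lieForm.orthogonal (g x)) : IsLegendreMap g := by
  refine ⟨hg, fun x => ?_, fun V hV u w hu hw x hxV v => ?_⟩
  · obtain ⟨U, hU, hx, s, t, hs, ht, hspan, -⟩ := hframe x
    exact ⟨U, hU, hx, s, t, hs, ht, hspan⟩
  obtain ⟨U, hU, hxU, s, t, hs, ht, hspan, hperp⟩ := hframe x
  have hsymm {s : M → R42} (hs : IsSection g U s)
      (hds : sectionDeriv s x v ∈ lieForm.orthogonal (g x)) :
      lieForm (s x) (sectionDeriv w x v) = 0 := by
    have hnull : ∀ᶠ y in nhds x, lieForm (s y) (w y) = 0 := by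
      filter_upwards [hU.mem_nhds hxU, hV.mem_nhds hxV] with y hyU hyV
      exact (hg y).2 _ (hs.2 y hyU) _ (hw.2 y hyV)
    have hsum := lieForm_sectionDeriv_add_of_eventually_eq
      (hs.mdifferentiableAt (hU.mem_nhds hxU)) (hw.mdifferentiableAt (hV.mem_nhds hxV)) hnull v
    rwa [lieForm_comm (sectionDeriv s x v), hds _ (hw.2 x hxV), add_zero] at hsum
  have hu_mem := hspan x hxU ▸ hu.2 x hxV
  obtain ⟨α, β, hαβ⟩ := Submodule.mem_span_pair.1 hu_mem
  simp [← hαβ, hsymm hs (hperp v).1, hsymm ht (hperp v).2]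

theorem IsLegendreMap.invertMap (hf : IsLegendreMap f) (hb : lieForm b b ≠ 0) :
    IsLegendreMap (invertMap b f) := by
  refine isLegendreMap_of_frame (fun x => (hf.1 x).invert hb) fun x => ?_
  obtain ⟨U, hU, hx, s, t, hs, ht, hspan⟩ := hf.2.1 x
  have hsection {s : M → R42} (hs : IsSection f U s) :
      IsSection (LieSphere.invertMap b f) U fun y => lieInversion b (s y) :=
    ⟨(lieInversion b).toContinuousLinearMap.contMDiff.comp_contMDiffOn hs.1,
      fun y hy => Submodule.mem_map_of_mem (hs.2 y hy)⟩
  have hperp {s : M → R42} (hs : IsSection f U s) (v : TangentSpace (𝓡 2) x) :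
      sectionDeriv (fun y => lieInversion b (s y)) x v ∈
        lieForm.orthogonal (LieSphere.invertMap b f x) := by
    rintro _ ⟨u, hu, rfl⟩
    rw [sectionDeriv_map _ (hs.mdifferentiableAt (hU.mem_nhds hx))]
    exact (lieForm_lieInversion hb _ _).trans (hf.sectionDeriv_mem_orthogonal hU hs hx v u hu)
  refine ⟨U, hU, hx, _, _, hsection hs, hsection ht, fun y hy => ?_,
    fun v => ⟨hperp hs v, hperp ht v⟩⟩
  rw [LieSphere.invertMap, invert, hspan y hy, Submodule.map_span, Set.image_pair]

theorem IsLegendreMap.umbilicMap (hf : IsLegendreMap f) (hbb : lieForm b b = 0)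
    (hb : ∀ x, b ∉ f x) : IsLegendreMap (umbilicMap b f) := by
  refine isLegendreMap_of_frame (fun x => (hf.1 x).umbilicElement hbb (hb x)) fun x => ?_
  obtain ⟨U, hU, hx, s, t, hs, ht, hspan⟩ := hf.2.1 x
  set τ : M → R42 := fun y => lieForm (t y) b • s y - lieForm (s y) b • t y with hτ
  have hτf : IsSection f U τ :=
    ⟨((contMDiffOn_lieForm ht.1 contMDiffOn_const).smul hs.1).sub
      ((contMDiffOn_lieForm hs.1 contMDiffOn_const).smul ht.1), fun y hy =>
      sub_mem ((f y).smul_mem _ (hs.2 y hy)) ((f y).smul_mem _ (ht.2 y hy))⟩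
  have hτb (y : M) : lieForm (τ y) b = 0 := by
    simp [hτ, mul_comm]
  have hinf (y : M) (hy : y ∈ U) : f y ⊓ perp b = Submodule.span ℝ {τ y} := by
    have hbF := (hf.1 y).not_le_perp hbb.le (hb y)
    have hF := hf.1 y
    rw [hspan y hy] at hbF hF ⊢
    exact hF.inf_perp_span_pair hbF
  refine ⟨U, hU, hx, τ, fun _ => b, ⟨hτf.1, fun y hy => Submodule.mem_sup_left
      ⟨hτf.2 y hy, mem_perp_iff.2 (hτb y)⟩⟩, ⟨contMDiffOn_const, fun y _ =>
      Submodule.mem_sup_right (Submodule.mem_span_singleton_self b)⟩, fun y hy => ?_,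
    fun v => ⟨?_, sectionDeriv_const b v ▸ zero_mem _⟩⟩
  · rw [LieSphere.umbilicMap, umbilicElement, hinf y hy, Submodule.span_insert]
  · have hdτ : lieForm b (sectionDeriv τ x v) = 0 := by
      have hsum := lieForm_sectionDeriv_add_of_eventually_eq
        (hτf.mdifferentiableAt (hU.mem_nhds hx)) mdifferentiableAt_const (.of_forall hτb) v
      rwa [sectionDeriv_const, map_zero, zero_add, lieForm_comm] at hsum
    intro w hw
    obtain ⟨u, hu, _, hc, rfl⟩ := Submodule.mem_sup.1 hw
    obtain ⟨c, rfl⟩ := Submodule.mem_span_singleton.1 hc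
    have hu' := hf.sectionDeriv_mem_orthogonal hU hτf hx v u hu.1
    simp [show lieForm u _ = 0 from hu', hdτ]

end Sections

section DualVector

variable {m n s t : R42} {F : Submodule ℝ R42}

/-- The determinant of the functionals `⟨·, m⟩`, `⟨·, n⟩` on the pair `s, t`. -/
noncomputable def pairingDet (m n s t : R42) : ℝ :=
  lieForm s m * lieForm t n - lieForm s n * lieForm t m

/-- The vector of `span {s, t}` that has product `1` with `m` and `0` with `n`, by Cramer's rule
(the zero vector when the determinant vanishes). -/
noncomputable def dualVector (m n s t : R42) : R42 :=
  (pairingDet m n s t)⁻¹ • (lieForm t n • s - lieForm s n • t)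

theorem pairingDet_swap (m n s t : R42) : pairingDet n m s t = -pairingDet m n s t := by
  simp only [pairingDet]
  ring

theorem dualVector_mem (hs : s ∈ F) (ht : t ∈ F) : dualVector m n s t ∈ F :=
  F.smul_mem _ (sub_mem (F.smul_mem _ hs) (F.smul_mem _ ht))

theorem lieForm_dualVector_left (h : pairingDet m n s t ≠ 0) :
    lieForm (dualVector m n s t) m = 1 := by
  rw [dualVector, map_smul, LinearMap.smul_apply, smul_eq_mul, inv_mul_eq_one₀ h]
  simp only [pairingDet, map_sub, map_smul, LinearMap.sub_apply, LinearMap.smul_apply, smul_eq_mul]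
  ring

theorem lieForm_dualVector_right (m n s t : R42) : lieForm (dualVector m n s t) n = 0 := by
  simp [dualVector, mul_comm]

theorem IsContactElement.isDualFrame_dualVector (hF : IsContactElement F) (hs : s ∈ F)
    (ht : t ∈ F) (h : pairingDet m n s t ≠ 0) :
    IsDualFrame m n F (dualVector m n s t) (dualVector n m s t) where
  contact := hF
  left_mem := dualVector_mem hs ht
  right_mem := dualVector_mem hs ht
  qa := lieForm_dualVector_left h
  qp := lieForm_dualVector_right m n s t
  ra := lieForm_dualVector_right n m s t
  rp := lieForm_dualVector_left (by rwa [pairingDet_swap, neg_ne_zero])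

end DualVector

section DualFrames

variable {M : Type*} [TopologicalSpace M] [ChartedSpace (EuclideanSpace ℝ (Fin 2)) M]
  {a p : R42} {f : M → Submodule ℝ R42} {m n s t : M → R42} {U : Set M} {x : M}

/-- A smooth local frame `q, r` of `f` which is dual to the functionals `⟨·, m⟩` and `⟨·, n⟩`. -/
structure IsDualFrameOn (m n : M → R42) (f : M → Submodule ℝ R42) (U : Set M) (q r : M → R42) :
    Prop where
  isOpen : IsOpen U
  left : IsSection f U q
  right : IsSection f U r
  dual : ∀ y ∈ U, IsDualFrame (m y) (n y) (f y) (q y) (r y)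

theorem contMDiffOn_pairingDet (hm : ContMDiffOn (𝓡 2) 𝓘(ℝ, R42) ∞ m U)
    (hn : ContMDiffOn (𝓡 2) 𝓘(ℝ, R42) ∞ n U) (hs : ContMDiffOn (𝓡 2) 𝓘(ℝ, R42) ∞ s U)
    (ht : ContMDiffOn (𝓡 2) 𝓘(ℝ, R42) ∞ t U) :
    ContMDiffOn (𝓡 2) 𝓘(ℝ, ℝ) ∞ (fun y => pairingDet (m y) (n y) (s y) (t y)) U :=
  ((contMDiffOn_lieForm hs hm).mul (contMDiffOn_lieForm ht hn)).sub
    ((contMDiffOn_lieForm hs hn).mul (contMDiffOn_lieForm ht hm))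

theorem contMDiffOn_dualVector (hm : ContMDiffOn (𝓡 2) 𝓘(ℝ, R42) ∞ m U)
    (hn : ContMDiffOn (𝓡 2) 𝓘(ℝ, R42) ∞ n U) (hs : ContMDiffOn (𝓡 2) 𝓘(ℝ, R42) ∞ s U)
    (ht : ContMDiffOn (𝓡 2) 𝓘(ℝ, R42) ∞ t U)
    (h : ∀ y ∈ U, pairingDet (m y) (n y) (s y) (t y) ≠ 0) :
    ContMDiffOn (𝓡 2) 𝓘(ℝ, R42) ∞ (fun y => dualVector (m y) (n y) (s y) (t y)) U :=
  ((contMDiffOn_pairingDet hm hn hs ht).inv₀ h).smul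
    (((contMDiffOn_lieForm ht hn).smul hs).sub ((contMDiffOn_lieForm hs hn).smul ht))

theorem IsLegendreMap.exists_isDualFrameOn (hf : IsLegendreMap f) (hU : IsOpen U) (hx : x ∈ U)
    (hm : ContMDiffOn (𝓡 2) 𝓘(ℝ, R42) ∞ m U) (hn : ContMDiffOn (𝓡 2) 𝓘(ℝ, R42) ∞ n U)
    (hzero : ∀ v ∈ f x, lieForm v (m x) = 0 → lieForm v (n x) = 0 → v = 0) :
    ∃ V ⊆ U, x ∈ V ∧ ∃ q r, IsDualFrameOn m n f V q r := by
  obtain ⟨N, hN, hxN, s, t, hs, ht, hspan⟩ := hf.2.1 x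
  have hdet_x : pairingDet (m x) (n x) (s x) (t x) ≠ 0 :=
    det_ne_zero_of_linearIndependent (φ := lieForm.flip (m x)) (ψ := lieForm.flip (n x))
      (hspan x hxN ▸ hf.1 x).linearIndependent (hspan x hxN ▸ hzero)
  have hopen := (contMDiffOn_pairingDet (hm.mono Set.inter_subset_right)
    (hn.mono Set.inter_subset_right) (hs.1.mono Set.inter_subset_left)
    (ht.1.mono Set.inter_subset_left)).continuousOn.isOpen_inter_preimage (hN.inter hU)
    isOpen_compl_singleton (t := {0}ᶜ)
  set V := N ∩ U ∩ (fun y => pairingDet (m y) (n y) (s y) (t y)) ⁻¹' {0}ᶜ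
  have hVN : V ⊆ N := fun y hy => hy.1.1
  have hVU : V ⊆ U := fun y hy => hy.1.2
  have hdet (y : M) (hy : y ∈ V) : pairingDet (m y) (n y) (s y) (t y) ≠ 0 := hy.2
  have hdual (y : M) (hy : y ∈ V) :=
    (hf.1 y).isDualFrame_dualVector (hs.2 y (hVN hy)) (ht.2 y (hVN hy)) (hdet y hy)
  refine ⟨V, hVU, ⟨⟨hxN, hx⟩, hdet_x⟩, _, _, hopen, ⟨?_, fun y hy => (hdual y hy).left_mem⟩,
    ⟨?_, fun y hy => (hdual y hy).right_mem⟩, hdual⟩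
  · exact contMDiffOn_dualVector (hm.mono hVU) (hn.mono hVU) (hs.1.mono hVN) (ht.1.mono hVN) hdet
  · exact contMDiffOn_dualVector (hn.mono hVU) (hm.mono hVU) (hs.1.mono hVN) (ht.1.mono hVN)
      fun y hy => by rw [pairingDet_swap, neg_ne_zero]; exact hdet y hy

theorem IsLegendreMap.exists_isDualFrameOn_const (hf : IsLegendreMap f) (ha : lieForm a a ≠ 0)
    (hp : lieForm p p < 0)
    (hpt : pointSphere p (f x) ≠ pointSphere p (invert a (f x))) :
    ∃ V, x ∈ V ∧ ∃ q r, IsDualFrameOn (fun _ => a) (fun _ => p) f V q r := by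
  obtain ⟨V, -, hV⟩ := hf.exists_isDualFrameOn isOpen_univ (Set.mem_univ x) contMDiffOn_const
    contMDiffOn_const fun v hv => eq_zero_of_pointSphere_ne (hf.1 x) ha hp hpt hv
  exact ⟨V, hV⟩

end DualFrames

section ParallelFrames

variable {ι : Type*} {G H : Submodule ℝ R42} {e : ι → R42} {v : R42}

/-- The coordinates of a vector with respect to the basis dual to `e`. -/
noncomputable def pairing (e : ι → R42) : R42 →ₗ[ℝ] ι → ℝ :=
  LinearMap.pi fun i => lieForm.flip (e i)

theorem eq_zero_of_lieForm_eq_zero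
    (hW : Disjoint (Submodule.span ℝ (Set.range e))
      (lieForm.orthogonal (Submodule.span ℝ (Set.range e))))
    (hv : v ∈ Submodule.span ℝ (Set.range e)) (hve : ∀ i, lieForm v (e i) = 0) : v = 0 := by
  refine Submodule.disjoint_def.1 hW v hv (mem_orthogonal_span_iff.2 ?_)
  rintro _ ⟨i, rfl⟩
  exact (lieForm_comm _ _).trans (hve i)

theorem eq_of_map_pairing_eq
    (hW : Disjoint (Submodule.span ℝ (Set.range e))
      (lieForm.orthogonal (Submodule.span ℝ (Set.range e))))
    (hG : G ≤ Submodule.span ℝ (Set.range e)) (hH : H ≤ Submodule.span ℝ (Set.range e))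
    (hGH : G.map (pairing e) = H.map (pairing e)) : G = H := by
  have hle {G H : Submodule ℝ R42} (hG : G ≤ Submodule.span ℝ (Set.range e))
      (hH : H ≤ Submodule.span ℝ (Set.range e)) (hGH : G.map (pairing e) = H.map (pairing e)) :
      G ≤ H := by
    intro v hv
    obtain ⟨w, hw, hwv⟩ : pairing e v ∈ H.map (pairing e) := hGH ▸ Submodule.mem_map_of_mem hv
    have hvw : v - w = 0 := eq_zero_of_lieForm_eq_zero hW (sub_mem (hG hv) (hH hw)) fun i => by
      have hi : lieForm w (e i) = lieForm v (e i) := congrFun hwv i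
      rw [map_sub, LinearMap.sub_apply, hi, sub_self]
    rwa [sub_eq_zero.1 hvw]
  exact le_antisymm (hle hG hH hGH) (hle hH hG hGH.symm)

theorem IsContactElement.exists_pair_eq_zero (hG : IsContactElement G)
    (hW : Disjoint (Submodule.span ℝ (Set.range e))
      (lieForm.orthogonal (Submodule.span ℝ (Set.range e))))
    (hGW : G ≤ Submodule.span ℝ (Set.range e)) :
    ∃ i j, ∀ v ∈ G, lieForm v (e i) = 0 → lieForm v (e j) = 0 → v = 0 := by
  have hne {v : R42} (hv : v ∈ G) (hv0 : v ≠ 0) : ∃ i, lieForm v (e i) ≠ 0 := by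
    by_contra! hve
    exact hv0 (eq_zero_of_lieForm_eq_zero hW (hGW hv) hve)
  have : Nontrivial G := Module.nontrivial_of_finrank_pos (R := ℝ) (by rw [hG.1]; norm_num)
  obtain ⟨u, hu, hu0⟩ :=
    Submodule.exists_mem_ne_zero_of_ne_bot ((Submodule.nontrivial_iff_ne_bot (p := G)).1 this)
  obtain ⟨i, hui⟩ := hne hu hu0
  obtain ⟨w, hw, -, hw0, hspan⟩ :=
    hG.exists_inf_perp_eq_span fun hle => hui (mem_perp_iff.1 (hle hu))
  obtain ⟨j, hwj⟩ := hne hw hw0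
  refine ⟨i, j, fun v hv hvi hvj => ?_⟩
  have hvw : v ∈ Submodule.span ℝ {w} := hspan ▸ ⟨hv, mem_perp_iff.2 hvi⟩
  obtain ⟨c, rfl⟩ := Submodule.mem_span_singleton.1 hvw
  have hc : c = 0 := by simpa [hwj] using hvj
  rw [hc, zero_smul]

end ParallelFrames

section ParallelFrameOn

variable {M : Type*} [TopologicalSpace M] [ChartedSpace (EuclideanSpace ℝ (Fin 2)) M]
  {ι : Type*} {a p : R42} {f g h W : M → Submodule ℝ R42} {e : ι → M → R42} {q r s : M → R42}
  {U V : Set M} {x y : M} {i j : ι}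

/-- A smooth local frame `e` of a bundle `W` of nondegenerate four-dimensional subspaces which is
parallel for the connection on `W` induced by the metric: the derivatives of the `e i` have no
component in `W`. -/
structure IsParallelFrameOn (W : M → Submodule ℝ R42) (U : Set M) (e : ι → M → R42) : Prop where
  isOpen : IsOpen U
  contMDiffOn : ∀ i, ContMDiffOn (𝓡 2) 𝓘(ℝ, R42) ∞ (e i) U
  span_eq : ∀ y ∈ U, Submodule.span ℝ (Set.range fun i => e i y) = W y
  disjoint_orthogonal : ∀ y ∈ U, Disjoint (W y) (lieForm.orthogonal (W y))
  finrank_eq : ∀ y ∈ U, finrank ℝ (W y) = 4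
  sectionDeriv_mem : ∀ i, ∀ y ∈ U, ∀ v, sectionDeriv (e i) y v ∈ lieForm.orthogonal (W y)

theorem IsDualFrameOn.isParallelFrameOn (hf : IsLegendreMap f)
    (hqr : IsDualFrameOn (fun _ => a) (fun _ => p) f U q r) :
    IsParallelFrameOn (fun y => f y ⊔ Submodule.span ℝ {a, p}) U
      ![q, r, fun _ => a, fun _ => p] := by
  have hconst {s : M → R42} {b : R42} {c : ℝ} (hs : IsSection f U s)
      (hsb : ∀ y ∈ U, lieForm (s y) b = c) {y : M} (hy : y ∈ U) (v : TangentSpace (𝓡 2) y) :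
      lieForm b (sectionDeriv s y v) = 0 := by
    have hU := hqr.isOpen.mem_nhds hy
    have hsum := lieForm_sectionDeriv_add_of_eventually_eq (hs.mdifferentiableAt hU)
      mdifferentiableAt_const (Filter.eventually_of_mem hU hsb) v
    rwa [sectionDeriv_const, map_zero, zero_add, lieForm_comm] at hsum
  have hsection {s : M → R42} {c d : ℝ} (hs : IsSection f U s)
      (hsa : ∀ y ∈ U, lieForm (s y) a = c) (hsp : ∀ y ∈ U, lieForm (s y) p = d) {y : M}
      (hy : y ∈ U) (v : TangentSpace (𝓡 2) y) :
      sectionDeriv s y v ∈ lieForm.orthogonal (f y ⊔ Submodule.span ℝ {a, p}) := by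
    rw [← (f y).span_eq, ← Submodule.span_union, mem_orthogonal_span_iff]
    rintro w (hw | rfl | rfl)
    exacts [hf.sectionDeriv_mem_orthogonal hqr.isOpen hs hy v w hw, hconst hs hsa hy v,
      hconst hs hsp hy v]
  refine ⟨hqr.isOpen, fun i => ?_, fun y hy => ?_, fun y hy => (hqr.dual y hy).disjoint_orthogonal,
    fun y hy => (hqr.dual y hy).finrank_sup, fun i y hy v => ?_⟩
  · fin_cases i
    exacts [hqr.left.1, hqr.right.1, contMDiffOn_const, contMDiffOn_const]
  · rw [(hqr.dual y hy).sup_eq_span]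
    congr 2
    ext1 i
    fin_cases i <;> rfl
  · fin_cases i
    · exact hsection hqr.left (fun y hy => (hqr.dual y hy).qa)
        (fun y hy => (hqr.dual y hy).qp) hy v
    · exact hsection hqr.right (fun y hy => (hqr.dual y hy).ra)
        (fun y hy => (hqr.dual y hy).rp) hy v
    all_goals exact (sectionDeriv_const _ v).symm ▸ zero_mem _

namespace IsParallelFrameOn

theorem mdifferentiableAt (he : IsParallelFrameOn W U e) (hy : y ∈ U) (i : ι) :
    MDifferentiableAt (𝓡 2) 𝓘(ℝ, R42) (e i) y :=
  ((he.contMDiffOn i).contMDiffAt (he.isOpen.mem_nhds hy)).mdifferentiableAt (by simp)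

/-- As `g` is Legendre, `ds` lies in `g` up to components normal to `W`; its products with `e i` and
`e j` vanish, which leaves only the normal components. -/
theorem sectionDeriv_mem_orthogonal (he : IsParallelFrameOn W U e) (hg : IsLegendreMap g)
    (hgW : ∀ y ∈ U, g y ≤ W y) (hVU : V ⊆ U) (hqr : IsDualFrameOn (e i) (e j) g V q r)
    (hs : IsSection g V s) {c d : ℝ} (hsi : ∀ y ∈ V, lieForm (s y) (e i y) = c)
    (hsj : ∀ y ∈ V, lieForm (s y) (e j y) = d) (hy : y ∈ V) (v : TangentSpace (𝓡 2) y) :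
    sectionDeriv s y v ∈ lieForm.orthogonal (W y) := by
  have hyU := hVU hy
  have hV := hqr.isOpen.mem_nhds hy
  have hpair {l : ι} {c : ℝ} (hl : ∀ y ∈ V, lieForm (s y) (e l y) = c) :
      lieForm (sectionDeriv s y v) (e l y) = 0 := by
    have hsum := lieForm_sectionDeriv_add_of_eventually_eq (hs.mdifferentiableAt hV)
      (he.mdifferentiableAt hyU l) (Filter.eventually_of_mem hV hl) v
    rwa [he.sectionDeriv_mem l y hyU v _ (hgW y hyU (hs.2 y hy)), zero_add] at hsum
  have hds := hg.sectionDeriv_mem_orthogonal hqr.isOpen hs hy v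
  rw [(hg.1 y).orthogonal_eq_sup (hgW y hyU) (he.disjoint_orthogonal y hyU)
    (he.finrank_eq y hyU)] at hds
  obtain ⟨k, hk, n, hn, hkn⟩ := Submodule.mem_sup.1 hds
  have hmem (l : ι) : e l y ∈ W y := he.span_eq y hyU ▸ Submodule.subset_span ⟨l, rfl⟩
  have hpair_k {l : ι} {c : ℝ} (hl : ∀ y ∈ V, lieForm (s y) (e l y) = c) :
      lieForm k (e l y) = 0 := by
    have hkl := hpair hl
    rwa [← hkn, map_add, LinearMap.add_apply, lieForm_comm n, hn _ (hmem l), add_zero] at hkl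
  have hk0 : k = 0 := by
    rw [← (hqr.dual y hy).combination_eq_of_mem hk, hpair_k hsi, hpair_k hsj, zero_smul, zero_smul,
      add_zero]
  rwa [← hkn, hk0, zero_add]

variable [IsManifold (𝓡 2) 1 M]

theorem eventually_pairing_eq [Finite ι] (he : IsParallelFrameOn W U e)
    (hsW : ∀ᶠ y in nhds x, s y ∈ W y)
    (hs : ∀ᶠ y in nhds x, MDifferentiableAt (𝓡 2) 𝓘(ℝ, R42) s y ∧
      ∀ v, sectionDeriv s y v ∈ lieForm.orthogonal (W y)) (hx : x ∈ U) :
    ∀ᶠ y in nhds x, pairing (e · y) (s y) = pairing (e · x) (s x) := by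
  have hcoord (l : ι) : ∀ᶠ y in nhds x, lieForm (s y) (e l y) = lieForm (s x) (e l x) := by
    refine eventually_eq_of_hasMFDerivAt_zero (I := 𝓡 2) ?_
    filter_upwards [he.isOpen.mem_nhds hx, hsW, hs] with y hy hsy hdsy
    refine (hasMFDerivAt_lieForm_zero_iff hdsy.1 (he.mdifferentiableAt hy l)).2 fun v => ?_
    have hel : e l y ∈ W y := he.span_eq y hy ▸ Submodule.subset_span ⟨l, rfl⟩
    rw [he.sectionDeriv_mem l y hy v _ hsy, lieForm_comm _ (e l y), hdsy.2 v _ hel, add_zero]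
  filter_upwards [Filter.eventually_all.2 hcoord] with y hy
  exact funext hy

theorem eventually_map_pairing_eq [Finite ι] (he : IsParallelFrameOn W U e)
    (hg : IsLegendreMap g) (hgW : ∀ y ∈ U, g y ≤ W y) (hx : x ∈ U) :
    ∀ᶠ y in nhds x, (g y).map (pairing (e · y)) = (g x).map (pairing (e · x)) := by
  have hspan := he.span_eq x hx
  obtain ⟨i, j, hij⟩ := (hg.1 x).exists_pair_eq_zero (e := (e · x))
    (hspan ▸ he.disjoint_orthogonal x hx) (hspan ▸ hgW x hx)
  obtain ⟨V, hVU, hxV, q, r, hqr⟩ :=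
    hg.exists_isDualFrameOn he.isOpen hx (he.contMDiffOn i) (he.contMDiffOn j) hij
  have hV := hqr.isOpen.mem_nhds hxV
  have hconst {s : M → R42} {c d : ℝ} (hs : IsSection g V s)
      (hsi : ∀ y ∈ V, lieForm (s y) (e i y) = c) (hsj : ∀ y ∈ V, lieForm (s y) (e j y) = d) :
      ∀ᶠ y in nhds x, pairing (e · y) (s y) = pairing (e · x) (s x) := by
    refine he.eventually_pairing_eq ?_ ?_ hx <;> filter_upwards [hV] with y hy
    · exact hgW y (hVU hy) (hs.2 y hy)
    · exact ⟨hs.mdifferentiableAt (hqr.isOpen.mem_nhds hy),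
        he.sectionDeriv_mem_orthogonal hg hgW hVU hqr hs hsi hsj hy⟩
  filter_upwards [hV, hconst hqr.left (fun y hy => (hqr.dual y hy).qa) fun y hy =>
      (hqr.dual y hy).qp, hconst hqr.right (fun y hy => (hqr.dual y hy).ra) fun y hy =>
      (hqr.dual y hy).rp] with y hy hq hr
  rw [(hqr.dual y hy).eq_span, (hqr.dual x hxV).eq_span, Submodule.map_span, Submodule.map_span,
    Set.image_pair, Set.image_pair, hq, hr]

end IsParallelFrameOn

theorem IsLegendreMap.eq_of_eq_at [IsManifold (𝓡 2) 1 M] [PreconnectedSpace M] [Finite ι]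
    (hg : IsLegendreMap g) (hh : IsLegendreMap h)
    (hW : ∀ x, ∃ U, x ∈ U ∧ ∃ e : ι → M → R42, IsParallelFrameOn W U e)
    (hgW : ∀ x, g x ≤ W x) (hhW : ∀ x, h x ≤ W x) {x₀ : M} (h₀ : g x₀ = h x₀) : g = h := by
  have hlocal : IsLocallyConstant fun x => g x = h x := by
    refine (IsLocallyConstant.iff_eventually_eq _).2 fun x => ?_
    obtain ⟨U, hx, e, he⟩ := hW x
    have hiff {y : M} (hy : y ∈ U) :
        g y = h y ↔ (g y).map (pairing (e · y)) = (h y).map (pairing (e · y)) := by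
      have hspan := he.span_eq y hy
      exact ⟨fun hgh => hgh ▸ rfl, eq_of_map_pairing_eq (e := (e · y))
        (hspan ▸ he.disjoint_orthogonal y hy) (hspan ▸ hgW y) (hspan ▸ hhW y)⟩
    filter_upwards [he.isOpen.mem_nhds hx,
      he.eventually_map_pairing_eq hg (fun y _ => hgW y) hx,
      he.eventually_map_pairing_eq hh (fun y _ => hhW y) hx] with y hy hgy hhy
    rw [eq_iff_iff, hiff hy, hiff hx, hgy, hhy]
  funext x
  exact (hlocal.apply_eq_of_preconnectedSpace x x₀).mpr h₀

end ParallelFrameOn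

section Classification

variable {M : Type*} [TopologicalSpace M] [ChartedSpace (EuclideanSpace ℝ (Fin 2)) M]
  {a p : R42} {f g h : M → Submodule ℝ R42}

theorem IsLegendreMap.of_mem_inversionPencil (hf : IsLegendreMap f)
    (hdual : ∀ x, ∃ q r, IsDualFrame a p (f x) q r) (hh : h ∈ inversionPencil a p f) :
    IsLegendreMap h := by
  obtain ⟨b, hb, rfl⟩ | ⟨b, hb, rfl⟩ := hh
  · exact hf.invertMap hb.2
  · refine hf.umbilicMap hb.2.2 fun x => ?_
    obtain ⟨q, r, hqr⟩ := hdual x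
    exact hqr.notMem_of_mem_span hb.1 hb.2.1

theorem IsLegendreMap.and_le_sup_iff_exists_mem_inversionPencil [IsManifold (𝓡 2) 1 M]
    [ConnectedSpace M] (hf : IsLegendreMap f) (hp : lieForm p p = -1)
    (hframe : ∀ x, ∃ U, x ∈ U ∧ ∃ q r, IsDualFrameOn (fun _ => a) (fun _ => p) f U q r) :
    (IsLegendreMap g ∧ ∀ x, g x ≤ f x ⊔ Submodule.span ℝ {a, p}) ↔
      ∃ h ∈ inversionPencil a p f, g = h ∨ g = LieSphere.invertMap p h := by
  have hp0 : lieForm p p ≠ 0 := by rw [hp]; norm_num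
  have hdual (x : M) : ∃ q r, IsDualFrame a p (f x) q r := by
    obtain ⟨U, hx, q, r, hqr⟩ := hframe x
    exact ⟨q x, r x, hqr.dual x hx⟩
  have hle {h} (hh : h ∈ inversionPencil a p f) (x : M) :
      invert p (h x) ≤ f x ⊔ Submodule.span ℝ {a, p} :=
    invert_le_sup (Submodule.subset_span (by simp)) (le_sup_of_mem_inversionPencil hh x)
  have hleg {h} (hh : h ∈ inversionPencil a p f) := hf.of_mem_inversionPencil hdual hh
  constructor
  · rintro ⟨hg, hgW⟩
    obtain ⟨x₀⟩ := ‹ConnectedSpace M›.toNonempty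
    have hparallel (x : M) : ∃ U, x ∈ U ∧ ∃ e : Fin 4 → M → R42,
        IsParallelFrameOn (fun y => f y ⊔ Submodule.span ℝ {a, p}) U e := by
      obtain ⟨U, hx, q, r, hqr⟩ := hframe x
      exact ⟨U, hx, _, hqr.isParallelFrameOn hf⟩
    obtain ⟨q, r, hqr⟩ := hdual x₀
    obtain ⟨h, hh, h₀ | h₀⟩ := hqr.exists_mem_inversionPencil_eq hp (hg.1 x₀) (hgW x₀)
    · exact ⟨h, hh, .inl (hg.eq_of_eq_at (hleg hh) hparallel hgW
        (le_sup_of_mem_inversionPencil hh) h₀)⟩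
    · exact ⟨h, hh, .inr (hg.eq_of_eq_at ((hleg hh).invertMap hp0) hparallel hgW (hle hh) h₀)⟩
  · rintro ⟨h, hh, rfl | rfl⟩
    exacts [⟨hleg hh, le_sup_of_mem_inversionPencil hh⟩, ⟨(hleg hh).invertMap hp0, hle hh⟩]

end Classification

end LieSphere

theorem mainTheorem5 {M : Type*} [TopologicalSpace M]
    [ChartedSpace (EuclideanSpace ℝ (Fin 2)) M] [IsManifold (𝓡 2) ∞ M]
    (p : LieSphere.R42) (hp : LieSphere.lieForm p p = -1)
    (a : LieSphere.R42) (ha : LieSphere.lieForm a a ≠ 0)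
    (f : M → Submodule ℝ LieSphere.R42)
    (hf : LieSphere.IsRibaucourPair f (LieSphere.invertMap a f))
    (hpt : ∀ x, LieSphere.pointSphere p (f x) ≠
      LieSphere.pointSphere p (LieSphere.invert a (f x))) :
    (∀ x, LieSphere.IsCircle p
      (LieSphere.circleCongruence p f (LieSphere.invertMap a f) x)) ∧
    (∀ b ∈ LieSphere.nonnullSpan a p,
      LieSphere.IsLegendreMap (LieSphere.invertMap b f) ∧
      LieSphere.OrthogonalTo p (LieSphere.invertMap b f)
        (LieSphere.circleCongruence p f (LieSphere.invertMap a f))) ∧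
    (∀ b ∈ LieSphere.nonnullSpan a p, ∀ b' ∈ LieSphere.nonnullSpan a p, ∀ x,
      LieSphere.invert b (f x) = LieSphere.invert b' (f x) →
      Submodule.span ℝ {b} = Submodule.span ℝ {b'}) ∧
    (∀ b ∈ LieSphere.nullSpan a p,
      LieSphere.IsLegendreMap (LieSphere.umbilicMap b f) ∧
      LieSphere.OrthogonalTo p (LieSphere.umbilicMap b f)
        (LieSphere.circleCongruence p f (LieSphere.invertMap a f))) ∧
    (ConnectedSpace M → ∀ g : M → Submodule ℝ LieSphere.R42,
      (LieSphere.IsLegendreMap g ∧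
        LieSphere.OrthogonalTo p g
          (LieSphere.circleCongruence p f (LieSphere.invertMap a f))) ↔
        ∃ h : M → Submodule ℝ LieSphere.R42,
          ((∃ b ∈ LieSphere.nonnullSpan a p, h = LieSphere.invertMap b f) ∨
            (∃ b ∈ LieSphere.nullSpan a p, h = LieSphere.umbilicMap b f)) ∧
          (g = h ∨ g = LieSphere.invertMap p h)) := by
  have hp0 : LieSphere.lieForm p p < 0 := by rw [hp]; norm_num
  have hframe (x : M) := hf.1.exists_isDualFrameOn_const ha hp0 (hpt x)
  have hdual (x : M) : ∃ q r, LieSphere.IsDualFrame a p (f x) q r := by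
    obtain ⟨U, hx, q, r, hqr⟩ := hframe x
    exact ⟨q x, r x, hqr.dual x hx⟩
  have horth (g : M → Submodule ℝ LieSphere.R42) :=
    LieSphere.orthogonalTo_circleCongruence_iff (g := g) hdual ha hp
  have hpencil {h : M → Submodule ℝ LieSphere.R42} (hh : h ∈ LieSphere.inversionPencil a p f) :=
    And.intro (hf.1.of_mem_inversionPencil hdual hh)
      ((horth h).2 (LieSphere.le_sup_of_mem_inversionPencil hh))
  refine ⟨fun x => ?_, fun b hb => hpencil (.inl ⟨b, hb, rfl⟩), fun b hb b' hb' x heq => ?_,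
    fun b hb => hpencil (.inr ⟨b, hb, rfl⟩), fun _ g => ?_⟩
  · obtain ⟨q, r, hqr⟩ := hdual x
    exact hqr.isCircle_associatedCircle ha hp
  · obtain ⟨q, r, hqr⟩ := hdual x
    exact hqr.span_singleton_eq_of_invert_eq hb hb' heq
  · rw [horth]
    have : IsManifold (𝓡 2) 1 M := .of_le (n := ∞) (by simp)
    exact hf.1.and_le_sup_iff_exists_mem_inversionPencil hp hframe
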